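/- Let $\mathcal X$ be a measurable space, $\mu$ a probability measure on $\mathcal X$, and $1\le m<n$ integers. Let $K:\mathcal X^m\to[-1,1]$ be a measurable, permutation-symmetric kernel, and let $\mathbf X=(X_1,\dots,X_n)$ be a vector of independent random variables, each with law $\mu$. Put $$\theta=\mathbb E[K(X_1,\dots,X_m)],\qquad U(\mathbf X)=\binom nm^{-1}\sum_{1\le i_1<\dots<i_m\le n}K(X_{i_1},\dots,X_{i_m}),\qquad \sigma_1^2=\operatorname{Var}\big[\mathbb E[K(X_1,\dots,X_m)\mid X_1]\big].$$ For $f:\mathcal X^m\to\mathbb R$, $k\in\{1,\dots,m\}$ and $y,y'\in\mathcal X$ let $$D^k_{y,y'}f(\mathbf x)=f(x_1,\dots,x_{k-1},y,x_{k+1},\dots,x_m)-f(x_1,\dots,x_{k-1},y',x_{k+1},\dots,x_m).$$ For $m\ge 2$ and $X_1,\dots,X_m,X_1',X_2'$ independent with law $\mu$, let $$\beta=\mathbb E\Big[\big(D^1_{X_1,X_1'}D^2_{X_2,X_2'}K(X_1,\dots,X_m)\big)^2\Big],\qquad \gamma=\sup_{\mathbf x\in\mathcal X^m,\;y,y'\in\mathcal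 X}\mathbb E\Big[\big(D^1_{y,y'}D^2_{X_2,X_2'}K(x_1,\dots,x_m)\big)^2\Big];$$ for $m=1$ let $\beta=\gamma=0$. Let $\alpha=\sqrt{\beta/2}+\sqrt\gamma$. Then for every $t>0$ $$\Pr\{U(\mathbf X)-\theta>t\}\le\exp\left(\frac{-nt^2}{2m^2\sigma_1^2+m^4\beta/(2n)+\big(m^2\sqrt\gamma+\tfrac43 m\big)t}\right),$$ and for every $0<\delta\le 1/e$, with probability at least $1-\delta$, $$U(\mathbf X)-\theta\le\sqrt{\frac{2m^2\sigma_1^2\ln(1/\delta)}{n}}+\frac{(\alpha m^2+4m/3)\ln(1/\delta)}{n}.$$ -/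

import Mathlib

open MeasureTheory ProbabilityTheory

namespace UStat

noncomputable section

/-- The partial difference operator `D^k_{y,y'}`: the value of `f` after substituting `y` for the
`k`-th argument, minus its value after substituting `y'` there. -/
def partialDiff {𝒳 : Type*} {m : ℕ} (k : Fin m) (y y' : 𝒳) (f : (Fin m → 𝒳) → ℝ) :
    (Fin m → 𝒳) → ℝ :=
  fun x => f (Function.update x k y) - f (Function.update x k y')

/-- The complete U-statistic: the average of `K (x^W)` over all `m`-element subsets `W` of the index
set, where `x^W` lists the `x i`, `i ∈ W`, in increasing order of `i`. -/
def completeU {𝒳 : Type*} {m : ℕ} (n : ℕ) (K : (Fin m → 𝒳) → ℝ) (x : Fin n → 𝒳) : ℝ :=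
  ((n.choose m : ℕ) : ℝ)⁻¹ *
    ∑ W : {W : Finset (Fin n) // W.card = m}, K (fun j => x (W.1.orderEmbOfFin W.2 j))

variable {𝒳 : Type*} [MeasurableSpace 𝒳] {m : ℕ}

/-- The parameter `θ = E[K(X₁, …, X_m)]`, with `X₁, …, X_m` iid of law `μ`. -/
def theta (μ : Measure 𝒳) (K : (Fin m → 𝒳) → ℝ) : ℝ :=
  ∫ x, K x ∂(Measure.pi fun _ : Fin m => μ)

/-- The σ-algebra generated by the first `k` of the coordinates `X₁, …, X_m`. -/
abbrev firstCoords (𝒳 : Type*) [MeasurableSpace 𝒳] (m k : ℕ) : MeasurableSpace (Fin m → 𝒳) :=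
  MeasurableSpace.comap (fun (x : Fin m → 𝒳) (i : {i : Fin m // (i : ℕ) < k}) => x i)
    inferInstance

/-- The conditional variance `σ_k² = Var[E[K(X₁, …, X_m) | X₁, …, X_k]]`. -/
def sigmaSq (μ : Measure 𝒳) (K : (Fin m → 𝒳) → ℝ) (k : ℕ) : ℝ :=
  variance (condExp (firstCoords 𝒳 m k) (Measure.pi fun _ : Fin m => μ) K)
    (Measure.pi fun _ : Fin m => μ)

/-- `β(K) = E[(D¹_{X₁,X₁'} D²_{X₂,X₂'} K(X₁, …, X_m))²]` for iid `X₁, …, X_m, X₁', X₂'`.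
A kernel of a single argument has no mixed differences: then the value is `0`. -/
def beta (μ : Measure 𝒳) (K : (Fin m → 𝒳) → ℝ) : ℝ :=
  if h : 2 ≤ m then
    ∫ p : (Fin m → 𝒳) × 𝒳 × 𝒳,
      (partialDiff ⟨0, by omega⟩ (p.1 ⟨0, by omega⟩) p.2.1
        (partialDiff ⟨1, by omega⟩ (p.1 ⟨1, by omega⟩) p.2.2 K) p.1) ^ 2
      ∂((Measure.pi fun _ : Fin m => μ).prod (μ.prod μ))
  else 0

/-- `γ(K) = sup_{x, y, y'} E[(D¹_{y,y'} D²_{X₂,X₂'} K(x₁, …, x_m))²]` for iid `X₂, X₂'`.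
A kernel of a single argument has no mixed differences: then the value is `0`. -/
def gamma (μ : Measure 𝒳) (K : (Fin m → 𝒳) → ℝ) : ℝ :=
  if h : 2 ≤ m then
    ⨆ q : (Fin m → 𝒳) × 𝒳 × 𝒳,
      ∫ p : 𝒳 × 𝒳,
        (partialDiff ⟨0, by omega⟩ q.2.1 q.2.2 (partialDiff ⟨1, by omega⟩ p.1 p.2 K) q.1) ^ 2
        ∂(μ.prod μ)
  else 0

/-- `α(K) = √(β(K)/2) + √γ(K)`. -/
def alpha (μ : Measure 𝒳) (K : (Fin m → 𝒳) → ℝ) : ℝ :=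
  √(beta μ K / 2) + √(gamma μ K)

end

end UStat

/-! The proof is the entropy method. Let `f` be a bounded function of `n` independent variables, `V`
the sum of its coordinatewise conditional variances (`sumVar`), and `ψ(t) = log E[exp(t f)]`. Then
`Ent(exp(t f)) / E[exp(t f)] = t ψ'(t) - ψ(t)`. Subadditivity of entropy (`HasDualEnt.phiEnt_pi_le`)
and a one-variable Bennett estimate (`ent_exp_le_bennett`) bound this quantity by `½ (t / (1 - t b /
3))²` times the mean of `V` under the law tilted by `exp(t f)`, where `b` bounds `f x - f
(Function.update x k y)`.

The tilted mean of `V` is decoupled from `f` by the variational formula for entropy (`le_ent`), at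
the price of `log E[exp(θ V)]`. That term is controlled because `V` is self-bounding, `(V x - V x')²
≤ 2 r (V x + V x')` when `x'` differs from `x` in one coordinate (`log_expMoment_le_of_sq_sub_le`).
With the best `θ` this gives `t ψ' - ψ ≤ v t² / (2 (1 - c t)²)`, where `v ≥ E[V]` and `c = b / 3 +
√(R / 2)` with `R ≥ n r`. Herbst's argument integrates it, and Chernoff's bound yields
`measureReal_gt_le_bernstein`.

For the U-statistic, a proportion `m / n` of the kernels contains a given index and `m (m - 1) / (n
(n - 1))` a given pair. The first proportion gives `b = 2 m / n`. The second bounds the mixed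
differences: uniformly through `γ`, which gives `r` (`sumVar_sub_sq_le`), and on average through
`β`. Efron-Stein applied to the first differences of `U` bounds `E[V]` by a `σ₁²` term from their
means and a `β` term from their fluctuations (`integral_sumVar_le`). -/

namespace UStat

/-! ### Bounded measurable functions: integrability and Fubini without side conditions. -/

/-- Bounded measurable real functions. -/
structure BddMeas {α : Type*} [MeasurableSpace α] (f : α → ℝ) : Prop where
  meas : Measurable f
  bdd : ∃ C, ∀ x, |f x| ≤ C

namespace BddMeas

variable {α β : Type*} [MeasurableSpace α] [MeasurableSpace β] {f g : α → ℝ}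

theorem integrable (hf : BddMeas f) (μ : Measure α) [IsFiniteMeasure μ] : Integrable f μ := by
  obtain ⟨C, hC⟩ := hf.bdd
  exact Integrable.of_bound hf.meas.aestronglyMeasurable C (.of_forall hC)

theorem const (c : ℝ) : BddMeas fun _ : α => c := ⟨measurable_const, |c|, fun _ => le_rfl⟩

theorem add (hf : BddMeas f) (hg : BddMeas g) : BddMeas fun x => f x + g x := by
  obtain ⟨C, hC⟩ := hf.bdd
  obtain ⟨D, hD⟩ := hg.bdd
  exact ⟨hf.meas.add hg.meas, C + D, fun x => (abs_add_le _ _).trans (add_le_add (hC x) (hD x))⟩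

theorem mul (hf : BddMeas f) (hg : BddMeas g) : BddMeas fun x => f x * g x := by
  obtain ⟨C, hC⟩ := hf.bdd
  obtain ⟨D, hD⟩ := hg.bdd
  refine ⟨hf.meas.mul hg.meas, C * D, fun x => ?_⟩
  rw [abs_mul]
  exact mul_le_mul (hC x) (hD x) (abs_nonneg _) ((abs_nonneg _).trans (hC x))

theorem const_mul (c : ℝ) (hf : BddMeas f) : BddMeas fun x => c * f x := (const c).mul hf

theorem neg (hf : BddMeas f) : BddMeas fun x => -f x := by
  simpa using hf.const_mul (-1)

theorem sub (hf : BddMeas f) (hg : BddMeas g) : BddMeas fun x => f x - g x := by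
  simpa [sub_eq_add_neg] using hf.add hg.neg

theorem pow (hf : BddMeas f) (n : ℕ) : BddMeas fun x => f x ^ n := by
  obtain ⟨C, hC⟩ := hf.bdd
  refine ⟨hf.meas.pow_const n, C ^ n, fun x => ?_⟩
  rw [abs_pow]
  exact pow_le_pow_left₀ (abs_nonneg _) (hC x) n

theorem exp (hf : BddMeas f) : BddMeas fun x => Real.exp (f x) := by
  obtain ⟨C, hC⟩ := hf.bdd
  refine ⟨hf.meas.exp, Real.exp C, fun x => ?_⟩
  rw [Real.abs_exp]
  exact Real.exp_le_exp.2 ((le_abs_self _).trans (hC x))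

theorem sum {ι : Type*} (s : Finset ι) {F : ι → α → ℝ} (h : ∀ i ∈ s, BddMeas (F i)) :
    BddMeas fun x => ∑ i ∈ s, F i x := by
  classical
  induction s using Finset.induction_on with
  | empty => simpa using const 0
  | insert a s ha ih =>
    simp only [Finset.sum_insert ha]
    exact (h a (Finset.mem_insert_self _ _)).add
      (ih fun i hi => h i (Finset.mem_insert_of_mem hi))

theorem comp (hf : BddMeas f) {u : β → α} (hu : Measurable u) : BddMeas fun y => f (u y) := by
  obtain ⟨C, hC⟩ := hf.bdd
  exact ⟨hf.meas.comp hu, C, fun y => hC _⟩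

theorem of_mem_Icc {a b : ℝ} (hf : Measurable f) (h : ∀ x, f x ∈ Set.Icc a b) : BddMeas f :=
  ⟨hf, max |a| |b|, fun x => abs_le_max_abs_abs (h x).1 (h x).2⟩

theorem log {c : ℝ} (hc : 0 < c) (hf : BddMeas f) (h : ∀ x, c ≤ f x) :
    BddMeas fun x => Real.log (f x) := by
  obtain ⟨C, hC⟩ := hf.bdd
  exact of_mem_Icc (a := Real.log c) (b := Real.log C) hf.meas.log fun x =>
    ⟨Real.log_le_log hc (h x),
      Real.log_le_log (hc.trans_le (h x)) ((le_abs_self _).trans (hC x))⟩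

theorem integral_right {F : α × β → ℝ} (hF : BddMeas F) (ν : Measure β) [IsProbabilityMeasure ν] :
    BddMeas fun x => ∫ y, F (x, y) ∂ν := by
  obtain ⟨C, hC⟩ := hF.bdd
  refine ⟨(hF.meas.stronglyMeasurable.integral_prod_right' (ν := ν)).measurable, C, fun x => ?_⟩
  simpa using norm_integral_le_of_norm_le_const (μ := ν) (f := fun y => F (x, y))
    (.of_forall fun y => hC (x, y))

theorem section_right {F : α × β → ℝ} (hF : BddMeas F) (x : α) : BddMeas fun y => F (x, y) :=
  hF.comp measurable_prodMk_left

theorem section_left {F : α × β → ℝ} (hF : BddMeas F) (y : β) : BddMeas fun x => F (x, y) :=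
  hF.comp measurable_prodMk_right

theorem swap {F : α × β → ℝ} (hF : BddMeas F) : BddMeas fun p : β × α => F (p.2, p.1) :=
  hF.comp measurable_swap

theorem integral_comm {F : α × β → ℝ} (hF : BddMeas F) (μ : Measure α) (ν : Measure β)
    [IsProbabilityMeasure μ] [IsProbabilityMeasure ν] :
    ∫ x, ∫ y, F (x, y) ∂ν ∂μ = ∫ y, ∫ x, F (x, y) ∂μ ∂ν :=
  integral_integral_swap (f := fun x y => F (x, y)) (hF.integrable (μ.prod ν))

theorem integral_prod {F : α × β → ℝ} (hF : BddMeas F) (μ : Measure α) (ν : Measure β)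
    [IsProbabilityMeasure μ] [IsProbabilityMeasure ν] :
    ∫ p, F p ∂(μ.prod ν) = ∫ x, ∫ y, F (x, y) ∂ν ∂μ :=
  MeasureTheory.integral_prod F (hF.integrable (μ.prod ν))

end BddMeas

/-! ### Resampling one coordinate of a product measure. -/

section Resampling

variable {𝒳 : Type*} [MeasurableSpace 𝒳] {n : ℕ}

theorem measurable_update_prod (k : Fin n) :
    Measurable fun p : (Fin n → 𝒳) × 𝒳 => Function.update p.1 k p.2 :=
  measurable_update'

theorem measurePreserving_update (μ : Measure 𝒳) [IsProbabilityMeasure μ] (k : Fin n) :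
    MeasurePreserving (fun p : (Fin n → 𝒳) × 𝒳 => Function.update p.1 k p.2)
      ((Measure.pi fun _ : Fin n => μ).prod μ) (Measure.pi fun _ : Fin n => μ) := by
  refine ⟨measurable_update_prod k, ?_⟩
  symm
  refine Measure.pi_eq fun s hs => ?_
  rw [Measure.map_apply (measurable_update_prod k) (MeasurableSet.univ_pi hs)]
  have : (fun p : (Fin n → 𝒳) × 𝒳 => Function.update p.1 k p.2) ⁻¹' (Set.univ.pi s) =
      (Set.univ.pi (Function.update s k Set.univ)) ×ˢ (s k) := by
    ext ⟨x, y⟩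
    simp only [Set.mem_preimage, Set.mem_pi, Set.mem_univ, true_imp_iff, Set.mem_prod]
    constructor
    · intro h
      refine ⟨fun i => ?_, by simpa using h k⟩
      by_cases hi : i = k
      · subst hi; simp
      · simpa [hi] using h i
    · rintro ⟨h, h'⟩ i
      by_cases hi : i = k
      · subst hi; simpa using h'
      · simpa [hi] using h i
  rw [this, Measure.prod_prod, Measure.pi_pi, ← Finset.mul_prod_erase _ _ (Finset.mem_univ k),
    ← Finset.mul_prod_erase _ (fun i => μ (s i)) (Finset.mem_univ k)]
  simp only [Function.update_self, measure_univ, one_mul]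
  rw [mul_comm]
  congr 1
  refine Finset.prod_congr rfl fun i hi => ?_
  rw [Function.update_of_ne (Finset.ne_of_mem_erase hi)]

theorem BddMeas.update {F : (Fin n → 𝒳) → ℝ} (hF : BddMeas F) (k : Fin n) :
    BddMeas fun p : (Fin n → 𝒳) × 𝒳 => F (Function.update p.1 k p.2) :=
  hF.comp (measurable_update_prod k)

theorem BddMeas.update_right {F : (Fin n → 𝒳) → ℝ} (hF : BddMeas F) (k : Fin n)
    (x : Fin n → 𝒳) : BddMeas fun y : 𝒳 => F (Function.update x k y) :=
  hF.comp (measurable_update x)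

theorem BddMeas.update_left {F : (Fin n → 𝒳) → ℝ} (hF : BddMeas F) (k : Fin n)
    (y : 𝒳) : BddMeas fun x : Fin n → 𝒳 => F (Function.update x k y) :=
  hF.comp measurable_update_left

/-- This turns an inequality between integrals over one coordinate, valid for every value of the
others, into one between integrals over the product. -/
theorem integral_update (μ : Measure 𝒳) [IsProbabilityMeasure μ] {F : (Fin n → 𝒳) → ℝ}
    (hF : BddMeas F) (k : Fin n) :
    ∫ x, ∫ y, F (Function.update x k y) ∂μ ∂(Measure.pi fun _ : Fin n => μ) =
      ∫ x, F x ∂(Measure.pi fun _ : Fin n => μ) := by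
  rw [← (hF.update k).integral_prod]
  have h := measurePreserving_update μ k
  conv_rhs => rw [← h.map_eq]
  rw [integral_map h.measurable.aemeasurable hF.meas.aestronglyMeasurable]

theorem piFinSuccAbove_zero_symm_apply (p : 𝒳 × (Fin n → 𝒳)) :
    (MeasurableEquiv.piFinSuccAbove (fun _ : Fin (n + 1) => 𝒳) 0).symm p = Fin.cons p.1 p.2 := by
  simp [MeasurableEquiv.piFinSuccAbove, Fin.insertNthEquiv]

theorem measurable_finCons :
    Measurable fun p : 𝒳 × (Fin n → 𝒳) => (Fin.cons p.1 p.2 : Fin (n + 1) → 𝒳) := by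
  simpa only [← piFinSuccAbove_zero_symm_apply] using
    (MeasurableEquiv.piFinSuccAbove (fun _ : Fin (n + 1) => 𝒳) 0).symm.measurable

theorem integral_pi_succ (μ : Measure 𝒳) [IsProbabilityMeasure μ] {F : (Fin (n + 1) → 𝒳) → ℝ}
    (hF : BddMeas F) :
    ∫ x, F x ∂(Measure.pi fun _ : Fin (n + 1) => μ) =
      ∫ p, F (Fin.cons p.1 p.2) ∂(μ.prod (Measure.pi fun _ : Fin n => μ)) := by
  have h := (measurePreserving_piFinSuccAbove (fun _ : Fin (n + 1) => μ) 0).symm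
  rw [← h.map_eq, integral_map h.measurable.aemeasurable hF.meas.aestronglyMeasurable]
  simp only [piFinSuccAbove_zero_symm_apply]

end Resampling

/-! ### Tensorization of `φ`-entropies, for the variance and the logarithmic entropy at once. -/

/-- The `φ`-entropy `E[φ(Z)] - φ(E[Z])`. -/
noncomputable def phiEnt {α : Type*} [MeasurableSpace α] (φ : ℝ → ℝ) (ν : Measure α)
    (Z : α → ℝ) : ℝ :=
  ∫ x, φ (Z x) ∂ν - φ (∫ x, Z x ∂ν)

/-- On bounded measurable functions with values in `[a, b]`, the `φ`-entropy with respect to `μ`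
is a maximum of affine functionals. -/
structure HasDualEnt {α : Type*} [MeasurableSpace α] (φ : ℝ → ℝ) (a b : ℝ)
    (μ : Measure α) : Prop where
  meas : Measurable φ
  bdd : ∃ C, ∀ x ∈ Set.Icc a b, |φ x| ≤ C
  dual : ∀ Z : α → ℝ, BddMeas Z → (∀ x, Z x ∈ Set.Icc a b) → ∃ (p : α → ℝ) (r : ℝ), BddMeas p ∧
    phiEnt φ μ Z = ∫ x, Z x * p x ∂μ + r ∧
    ∀ W : α → ℝ, BddMeas W → (∀ x, W x ∈ Set.Icc a b) → ∫ x, W x * p x ∂μ + r ≤ phiEnt φ μ W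

theorem integral_mem_Icc {α : Type*} [MeasurableSpace α] {a b : ℝ} {Z : α → ℝ} (hZ : BddMeas Z)
    (h : ∀ x, Z x ∈ Set.Icc a b) (ν : Measure α) [IsProbabilityMeasure ν] :
    ∫ x, Z x ∂ν ∈ Set.Icc a b := by
  constructor
  · simpa using integral_mono (integrable_const a) (hZ.integrable ν) fun x => (h x).1
  · simpa using integral_mono (hZ.integrable ν) (integrable_const b) fun x => (h x).2

section

variable {α β : Type*} [MeasurableSpace α] [MeasurableSpace β]
  {φ : ℝ → ℝ} {a b : ℝ} {μ : Measure α}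

theorem HasDualEnt.bddMeas (hφ : HasDualEnt φ a b μ) (Z : β → ℝ) (hZ : BddMeas Z)
    (hI : ∀ x, Z x ∈ Set.Icc a b) : BddMeas fun x => φ (Z x) := by
  obtain ⟨C, hC⟩ := hφ.bdd
  exact ⟨hφ.meas.comp hZ.meas, C, fun x => hC _ (hI x)⟩

theorem HasDualEnt.bddMeas_phiEnt (hφ : HasDualEnt φ a b μ) {γ : Type*} [MeasurableSpace γ]
    (ν : Measure γ) [IsProbabilityMeasure ν]
    {F : β × γ → ℝ} (hF : BddMeas F) (hI : ∀ p, F p ∈ Set.Icc a b) :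
    BddMeas fun x => phiEnt φ ν fun y => F (x, y) :=
  ((hφ.bddMeas F hF hI).integral_right ν).sub
    (hφ.bddMeas _ (hF.integral_right ν) fun x =>
      integral_mem_Icc (hF.section_right x) (fun y => hI (x, y)) ν)

variable [IsProbabilityMeasure μ]

/-- Convexity of the entropy: the affine functional that is exact at the averaged function lies
below the entropy of each section, and it commutes with averaging by Fubini. -/
theorem HasDualEnt.phiEnt_integral_le (hφ : HasDualEnt φ a b μ) (ν : Measure β)
    [IsProbabilityMeasure ν] {F : α × β → ℝ} (hF : BddMeas F) (hI : ∀ p, F p ∈ Set.Icc a b) :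
    phiEnt φ μ (fun y => ∫ x, F (y, x) ∂ν) ≤ ∫ x, phiEnt φ μ (fun y => F (y, x)) ∂ν := by
  obtain ⟨p, r, hp, heq, hle⟩ := hφ.dual _ (hF.integral_right ν) fun y =>
    integral_mem_Icc (hF.section_right y) (fun x => hI (y, x)) ν
  have hFp : BddMeas fun q : α × β => F q * p q.1 := hF.mul (hp.comp measurable_fst)
  have h1 : ∫ y, (∫ x, F (y, x) ∂ν) * p y ∂μ = ∫ x, ∫ y, F (y, x) * p y ∂μ ∂ν := by
    rw [← hFp.integral_comm μ ν]
    simp only [integral_mul_const]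
  have h2 : BddMeas fun x => ∫ y, F (y, x) * p y ∂μ := hFp.swap.integral_right μ
  rw [heq, h1]
  calc _ = ∫ x, (∫ y, F (y, x) * p y ∂μ + r) ∂ν := by
        rw [integral_add (h2.integrable ν) (integrable_const r)]; simp
    _ ≤ _ := integral_mono ((h2.add (.const r)).integrable ν)
        ((hφ.bddMeas_phiEnt (β := β) (γ := α) μ hF.swap fun q => hI _).integrable ν) fun x =>
          hle _ (hF.section_left x) fun y => hI _

/-- The entropy of `F` equals the mean entropy in the second variable plus the entropy of the
partial integral; convexity bounds the latter. -/
theorem HasDualEnt.phiEnt_prod_le (hφ : HasDualEnt φ a b μ) (ν : Measure β)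
    [IsProbabilityMeasure ν] {F : α × β → ℝ} (hF : BddMeas F) (hI : ∀ p, F p ∈ Set.Icc a b) :
    phiEnt φ (μ.prod ν) F ≤ ∫ y, phiEnt φ ν (fun x => F (y, x)) ∂μ +
      ∫ x, phiEnt φ μ (fun y => F (y, x)) ∂ν := by
  refine le_trans (le_of_eq ?_) (add_le_add_right (hφ.phiEnt_integral_le ν hF hI) _)
  have h1 := (hφ.bddMeas F hF hI)
  have h2 := (hφ.bddMeas _ (hF.integral_right ν) fun x =>
      integral_mem_Icc (hF.section_right x) (fun y => hI (x, y)) ν)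
  simp only [phiEnt]
  rw [integral_sub ((h1.integral_right ν).integrable μ) (h2.integrable μ), h1.integral_prod,
    hF.integral_prod]
  ring

end

section

variable {𝒳 : Type*} [MeasurableSpace 𝒳] {φ : ℝ → ℝ} {a b : ℝ} {μ : Measure 𝒳}
  [IsProbabilityMeasure μ]

/-- Subadditivity of the `φ`-entropy over product measures. -/
theorem HasDualEnt.phiEnt_pi_le (hφ : HasDualEnt φ a b μ) {n : ℕ} {F : (Fin n → 𝒳) → ℝ}
    (hF : BddMeas F) (hI : ∀ x, F x ∈ Set.Icc a b) :
    phiEnt φ (Measure.pi fun _ : Fin n => μ) F ≤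
      ∑ k, ∫ x, phiEnt φ μ (fun y => F (Function.update x k y))
        ∂(Measure.pi fun _ : Fin n => μ) := by
  induction n with
  | zero => simp [phiEnt, integral_unique, measureReal_def]
  | succ n ih =>
    set ν := Measure.pi fun _ : Fin n => μ with hν
    have hG : BddMeas fun p : 𝒳 × (Fin n → 𝒳) => F (Fin.cons p.1 p.2) :=
      hF.comp measurable_finCons
    have h0 : phiEnt φ (Measure.pi fun _ : Fin (n + 1) => μ) F =
        phiEnt φ (μ.prod ν) fun p => F (Fin.cons p.1 p.2) := by
      simp only [phiEnt]
      rw [integral_pi_succ μ (hφ.bddMeas F hF hI), integral_pi_succ μ hF]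
    have hk : ∀ k : Fin (n + 1), BddMeas fun x : Fin (n + 1) → 𝒳 =>
        phiEnt φ μ fun y => F (Function.update x k y) := fun k =>
      hφ.bddMeas_phiEnt μ (hF.update k) fun p => hI _
    rw [h0, Fin.sum_univ_succ, add_comm (∫ _, _ ∂_)]
    -- Coordinate `0` is split off; the induction hypothesis applies to the other coordinates with
    -- the first one frozen.
    refine (hφ.phiEnt_prod_le ν hG fun p => hI _).trans (add_le_add ?_ (le_of_eq ?_))
    · have hs : ∀ k : Fin n, BddMeas fun p : 𝒳 × (Fin n → 𝒳) =>
          phiEnt φ μ fun y => F (Fin.cons p.1 (Function.update p.2 k y)) := fun k => by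
        simpa only [Fin.cons_update] using (hk k.succ).comp measurable_finCons
      calc _ ≤ ∫ y, ∑ k : Fin n, ∫ x, phiEnt φ μ
            (fun z => F (Fin.cons y (Function.update x k z))) ∂ν ∂μ := by
            refine integral_mono ((hφ.bddMeas_phiEnt ν hG fun p => hI _).integrable μ)
              ((BddMeas.sum _ fun k _ => (hs k).integral_right ν).integrable μ) fun y => ?_
            exact ih (hG.section_right y) fun x => hI _
        _ = _ := by
            rw [integral_finsetSum _ fun k _ => ((hs k).integral_right ν).integrable μ]
            refine Finset.sum_congr rfl fun k _ => ?_
            rw [integral_pi_succ μ (hk k.succ), ← (hs k).integral_prod]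
            simp only [Fin.cons_update, hν]
    · have hc := (hk 0).comp (measurable_finCons (𝒳 := 𝒳) (n := n))
      rw [integral_pi_succ μ (hk 0), hc.integral_prod, hc.integral_comm]
      simp [hν]

end

/-! ### Variance as a `φ`-entropy. -/

section Square

variable {α : Type*} [MeasurableSpace α] {μ : Measure α} [IsProbabilityMeasure μ] {f g : α → ℝ}

theorem phiEnt_sq_eq (hf : BddMeas f) :
    phiEnt (· ^ 2) μ f = ∫ x, (f x - ∫ y, f y ∂μ) ^ 2 ∂μ := by
  simp only [phiEnt, sub_sq]
  rw [integral_add ((((hf.pow 2).sub ((hf.const_mul 2).mul (.const _))).integrable μ))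
    (integrable_const _), integral_sub ((hf.pow 2).integrable μ)
    (((hf.const_mul 2).mul (.const _)).integrable μ), integral_mul_const, integral_const_mul]
  simp
  ring

/-- The variance is half the mean squared difference of two independent copies. -/
theorem phiEnt_sq_eq_half (hf : BddMeas f) :
    phiEnt (· ^ 2) μ f = 1 / 2 * ∫ p, (f p.1 - f p.2) ^ 2 ∂(μ.prod μ) := by
  have h1 : BddMeas fun p : α × α => f p.1 := hf.comp measurable_fst
  have h2 : BddMeas fun p : α × α => f p.2 := hf.comp measurable_snd
  have h3 : ∫ p : α × α, 2 * f p.1 * f p.2 ∂(μ.prod μ) = 2 * ((∫ x, f x ∂μ) * ∫ x, f x ∂μ) := by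
    simp only [mul_assoc]
    rw [integral_const_mul, integral_prod_mul]
  have h4 : ∫ p : α × α, f p.1 ^ 2 ∂(μ.prod μ) = ∫ x, f x ^ 2 ∂μ := by
    simpa using integral_prod_mul (μ := μ) (ν := μ) (fun x => f x ^ 2) fun _ => (1 : ℝ)
  have h5 : ∫ p : α × α, f p.2 ^ 2 ∂(μ.prod μ) = ∫ x, f x ^ 2 ∂μ := by
    simpa using integral_prod_mul (μ := μ) (ν := μ) (fun _ => (1 : ℝ)) fun x => f x ^ 2
  simp only [phiEnt, sub_sq]
  rw [integral_add (((h1.pow 2).sub ((h1.const_mul 2).mul h2)).integrable _)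
    ((h2.pow 2).integrable _), integral_sub ((h1.pow 2).integrable _)
    (((h1.const_mul 2).mul h2).integrable _), h3, h4, h5]
  ring

/-- Expanding `Var(W - Z) ≥ 0` gives `Var W ≥ 2 Cov(W, Z) - Var Z`, which is affine in `W` and an
equality at `W = Z`. -/
theorem hasDualEnt_sq (a b : ℝ) : HasDualEnt (· ^ 2) a b μ where
  meas := measurable_id.pow_const 2
  bdd := ⟨max |a| |b| ^ 2, fun x hx => by
    rw [abs_pow]; exact pow_le_pow_left₀ (abs_nonneg _) (abs_le_max_abs_abs hx.1 hx.2) 2⟩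
  dual Z hZ _ := by
    have hp : BddMeas fun x => 2 * (Z x - ∫ y, Z y ∂μ) := (hZ.sub (.const _)).const_mul 2
    refine ⟨fun x => 2 * (Z x - ∫ y, Z y ∂μ), -phiEnt (· ^ 2) μ Z, hp, ?_, fun W hW _ => ?_⟩
    · have : ∫ x, Z x * (2 * (Z x - ∫ y, Z y ∂μ)) ∂μ = 2 * phiEnt (· ^ 2) μ Z := by
        have : ∀ x, Z x * (2 * (Z x - ∫ y, Z y ∂μ)) = 2 * Z x ^ 2 - 2 * (∫ y, Z y ∂μ) * Z x :=
          fun x => by ring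
        simp only [this, phiEnt]
        rw [integral_sub (((hZ.pow 2).const_mul 2).integrable μ) ((hZ.const_mul _).integrable μ),
          integral_const_mul, integral_const_mul]
        ring
      rw [this]; ring
    · have h0 : 0 ≤ ∫ x, ((W x - ∫ y, W y ∂μ) - (Z x - ∫ y, Z y ∂μ)) ^ 2 ∂μ :=
        integral_nonneg fun x => sq_nonneg _
      have hW' : BddMeas fun x => W x - ∫ y, W y ∂μ := hW.sub (.const _)
      have hZ' : BddMeas fun x => Z x - ∫ y, Z y ∂μ := hZ.sub (.const _)
      have h1 : ∀ x, ((W x - ∫ y, W y ∂μ) - (Z x - ∫ y, Z y ∂μ)) ^ 2 =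
          ((W x - ∫ y, W y ∂μ) ^ 2 + (Z x - ∫ y, Z y ∂μ) ^ 2) -
            (W x * (2 * (Z x - ∫ y, Z y ∂μ)) - (2 * ∫ y, W y ∂μ) * (Z x - ∫ y, Z y ∂μ)) :=
        fun x => by ring
      have h2 : ∫ x, (Z x - ∫ y, Z y ∂μ) ∂μ = 0 := by
        rw [integral_sub (hZ.integrable μ) (integrable_const _)]; simp
      simp only [h1] at h0
      rw [integral_sub (((hW'.pow 2).add (hZ'.pow 2)).integrable μ)
        (((hW.mul hp).sub (hZ'.const_mul _)).integrable μ),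
        integral_add ((hW'.pow 2).integrable μ) ((hZ'.pow 2).integrable μ),
        integral_sub ((hW.mul hp).integrable μ) ((hZ'.const_mul _).integrable μ),
        integral_const_mul, h2, ← phiEnt_sq_eq hW, ← phiEnt_sq_eq hZ] at h0
      linarith

end Square

/-! ### Logarithmic entropy and its variational formula. -/

section Entropy

variable {α : Type*} [MeasurableSpace α] {μ : Measure α} [IsProbabilityMeasure μ]

/-- The entropy functional `E[Z log Z] - E[Z] log E[Z]`. -/
noncomputable abbrev ent (μ : Measure α) (Z : α → ℝ) : ℝ :=
  phiEnt (fun z => z * Real.log z) μ Z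

theorem le_integral_of_le {c : ℝ} {Z : α → ℝ} (hZ : BddMeas Z) (h : ∀ x, c ≤ Z x) :
    c ≤ ∫ x, Z x ∂μ := by
  simpa using integral_mono (integrable_const c) (hZ.integrable μ) h

theorem mul_log_sub_ge {a b : ℝ} (ha : 0 < a) (hb : 0 < b) :
    a - b ≤ a * (Real.log a - Real.log b) := by
  have := Real.one_sub_inv_le_log_of_pos (div_pos ha hb)
  rw [Real.log_div ha.ne' hb.ne', inv_div] at this
  calc a - b = a * (1 - b / a) := by field_simp
    _ ≤ _ := mul_le_mul_of_nonneg_left this ha.le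

theorem BddMeas.mul_log {c : ℝ} (hc : 0 < c) {Z : α → ℝ} (hZ : BddMeas Z) (h : ∀ x, c ≤ Z x) :
    BddMeas fun x => Z x * Real.log (Z x) := hZ.mul (hZ.log hc h)

/-- The variational lower bound for the entropy. -/
theorem le_ent {c d : ℝ} (hc : 0 < c) (hd : 0 < d) {Z W : α → ℝ} (hZ : BddMeas Z)
    (hZc : ∀ x, c ≤ Z x) (hW : BddMeas W) (hWd : ∀ x, d ≤ W x) :
    ∫ x, Z x * (Real.log (W x) - Real.log (∫ y, W y ∂μ)) ∂μ ≤ ent μ Z := by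
  set z := ∫ x, Z x ∂μ with hz
  set w := ∫ x, W x ∂μ with hw
  have hz0 : 0 < z := hc.trans_le (le_integral_of_le hZ hZc)
  have hw0 : 0 < w := hd.trans_le (le_integral_of_le hW hWd)
  have hZl := hZ.mul_log hc hZc
  have hWl : BddMeas fun x => Z x * (Real.log (W x) - Real.log w) :=
    hZ.mul ((hW.log hd hWd).sub (.const _))
  -- Integrate `a - b ≤ a (log a - log b)` with `a = Z` and `b = (z / w) W`. The factor `z / w`
  -- gives both the same mean, so the left side integrates to `0`.
  have key : ∫ x, (Z x - z / w * W x) ∂μ ≤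
      ∫ x, ((Z x * Real.log (Z x) - Z x * Real.log z) -
        Z x * (Real.log (W x) - Real.log w)) ∂μ := by
    refine integral_mono ((hZ.sub (hW.const_mul _)).integrable μ)
      (((hZl.sub (hZ.mul (.const _))).sub hWl).integrable μ) fun x => ?_
    have h1 := mul_log_sub_ge (hc.trans_le (hZc x))
      (mul_pos (div_pos hz0 hw0) (hd.trans_le (hWd x)))
    rw [Real.log_mul (div_pos hz0 hw0).ne' (hd.trans_le (hWd x)).ne',
      Real.log_div hz0.ne' hw0.ne'] at h1
    simp only
    linarith
  rw [integral_sub ((hZl.sub (hZ.mul (.const _))).integrable μ) (hWl.integrable μ),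
    integral_sub (hZl.integrable μ) ((hZ.mul (.const _)).integrable μ), integral_mul_const,
    integral_sub (hZ.integrable μ) ((hW.const_mul _).integrable μ), integral_const_mul,
    ← hz, ← hw, div_mul_cancel₀ _ hw0.ne'] at key
  simp only [phiEnt, ← hz]
  linarith

/-- The supporting functional at `Z` has density `log Z - log E[Z]` and no constant term, the
entropy being homogeneous of degree one. The bound `0 < a` keeps the density bounded. -/
theorem hasDualEnt_mul_log {a b : ℝ} (ha : 0 < a) :
    HasDualEnt (fun z => z * Real.log z) a b μ where
  meas := measurable_id.mul Real.measurable_log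
  bdd := by
    obtain ⟨C, hC⟩ := isCompact_Icc.exists_bound_of_continuousOn (s := Set.Icc a b)
      (f := fun z : ℝ => z * Real.log z) (Real.continuous_mul_log.continuousOn)
    exact ⟨C, hC⟩
  dual Z hZ hI := by
    have hl := hZ.log ha fun x => (hI x).1
    refine ⟨fun x => Real.log (Z x) - Real.log (∫ y, Z y ∂μ), 0, hl.sub (.const _), ?_,
      fun W hW hWI => ?_⟩
    · simp only [phiEnt, mul_sub, add_zero]
      rw [integral_sub ((hZ.mul hl).integrable μ) ((hZ.mul (.const _)).integrable μ),
        integral_mul_const]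
    · rw [add_zero]
      exact le_ent ha ha hW (fun x => (hWI x).1) hZ fun x => (hI x).1

/-- The entropy is bounded by the Bregman divergence to any constant. -/
theorem ent_le {c d : ℝ} (hc : 0 < c) (hd : 0 < d) {Z : α → ℝ} (hZ : BddMeas Z)
    (hZc : ∀ x, c ≤ Z x) :
    ent μ Z ≤ ∫ x, (Z x * (Real.log (Z x) - Real.log d) - Z x + d) ∂μ := by
  have hZl := hZ.mul_log hc hZc
  -- The right side exceeds the entropy by the scalar divergence of `E[Z]` from `d`, which is
  -- nonnegative.
  have h1 := mul_log_sub_ge (hc.trans_le (le_integral_of_le (μ := μ) hZ hZc)) hd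
  simp only [mul_sub, phiEnt]
  rw [integral_add (((hZl.sub (hZ.mul (.const _))).sub hZ).integrable μ) (integrable_const _),
    integral_sub ((hZl.sub (hZ.mul (.const _))).integrable μ) (hZ.integrable μ),
    integral_sub (hZl.integrable μ) ((hZ.mul (.const _)).integrable μ), integral_mul_const]
  simp
  linarith

end Entropy

/-! ### Herbst's argument and an inequality for the exponential. -/

section Calculus

theorem monotoneOn_of_hasDerivAt_nonneg {s : Set ℝ} (hs : Convex ℝ s) {f f' : ℝ → ℝ}
    (hf : ∀ x ∈ s, HasDerivAt f (f' x) x) (h : ∀ x ∈ s, 0 ≤ f' x) : MonotoneOn f s :=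
  monotoneOn_of_deriv_nonneg hs (fun x hx => (hf x hx).continuousAt.continuousWithinAt)
    (fun x hx => (hf x (interior_subset hx)).differentiableAt.differentiableWithinAt)
    fun x hx => by rw [(hf x (interior_subset hx)).deriv]; exact h x (interior_subset hx)

/-- Herbst's argument: a function `H` with `H 0 = H' 0 = 0` and `x H' x ≤ H x` is nonpositive. -/
theorem nonpos_of_mul_deriv_le {H H' : ℝ → ℝ} {L : ℝ} (h0 : H 0 = 0) (h0' : HasDerivAt H 0 0)
    (hd : ∀ x ∈ Set.Ioo 0 L, HasDerivAt H (H' x) x) (hle : ∀ x ∈ Set.Ioo 0 L, x * H' x ≤ H x)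
    {x : ℝ} (hx : x ∈ Set.Ioo 0 L) : H x ≤ 0 := by
  -- `(H x / x)' = (x H' x - H x) / x² ≤ 0`, and `H x / x` tends to `H' 0 = 0` at the origin.
  have hmono : MonotoneOn (fun x => -(H x / x)) (Set.Ioo 0 L) := by
    refine monotoneOn_of_hasDerivAt_nonneg (convex_Ioo 0 L)
      (f' := fun x => -((H' x * x - H x * 1) / x ^ 2))
      (fun y hy => ((hd y hy).div (hasDerivAt_id y) hy.1.ne').neg) fun y hy => ?_
    have := hle y hy
    rw [neg_nonneg]
    exact div_nonpos_of_nonpos_of_nonneg (by linarith) (sq_nonneg y)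
  have hlim : Filter.Tendsto (fun s => H s / s) (nhdsWithin 0 (Set.Ioi 0)) (nhds 0) := by
    have := h0'.tendsto_slope_zero_right
    simpa [h0, div_eq_inv_mul] using this
  have : H x / x ≤ 0 := by
    refine ge_of_tendsto hlim ?_
    filter_upwards [Ioo_mem_nhdsGT hx.1] with s hs
    have := hmono (a := s) (b := x) ⟨hs.1, hs.2.trans hx.2⟩ hx hs.2.le
    simpa using this
  by_contra hc
  exact absurd this (not_le.2 (div_pos (not_le.1 hc) hx.1))

/-- For `z ≤ 0` the left side is at most `z² / 2`. For `0 ≤ z < 3` it is at most `½ (z / (1 - z /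
3))²`: both vanish at `0`, and the derivatives compare, `z exp z ≤ z / (1 - z / 3)³`, because `1 - z
/ 3 ≤ exp(-z / 3)`. -/
theorem mul_exp_sub_exp_add_one_le {z B : ℝ} (hB : 0 ≤ B) (hB3 : B < 3) (hz : z ≤ B) :
    z * Real.exp z - Real.exp z + 1 ≤ 1 / 2 * (1 - B / 3)⁻¹ ^ 2 * z ^ 2 := by
  have hψ : ∀ x : ℝ, HasDerivAt (fun x => x * Real.exp x - Real.exp x + 1) (x * Real.exp x) x :=
    fun x => (((hasDerivAt_id x).mul (Real.hasDerivAt_exp x)).sub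
      (Real.hasDerivAt_exp x)).add_const 1 |>.congr_deriv (by simp)
  have hB1 : 0 < 1 - B / 3 := by linarith
  rcases le_total z 0 with h | h
  · have hm : Monotone fun x : ℝ => (x * Real.exp x - Real.exp x + 1) - 1 / 2 * x ^ 2 := by
      rw [← monotoneOn_univ]
      refine monotoneOn_of_hasDerivAt_nonneg convex_univ
        (f' := fun x => x * Real.exp x - 1 / 2 * (2 * x))
        (fun x _ => (hψ x).sub (by simpa using (hasDerivAt_pow 2 x).const_mul (1 / 2 : ℝ)))
        fun x _ => ?_
      rcases le_total x 0 with hx | hx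
      · nlinarith [Real.exp_le_one_iff.2 hx]
      · nlinarith [Real.one_le_exp hx]
    have h1 := hm h
    simp at h1
    have h2 : 1 ≤ (1 - B / 3)⁻¹ := (one_le_inv₀ hB1).2 (by linarith)
    nlinarith [sq_nonneg z, one_le_pow₀ h2 (n := 2)]
  · have hm : MonotoneOn (fun x : ℝ => 1 / 2 * (x / (1 - x / 3)) ^ 2 -
        (x * Real.exp x - Real.exp x + 1)) (Set.Ico 0 3) := by
      refine monotoneOn_of_hasDerivAt_nonneg (convex_Ico 0 3)
        (f' := fun x => x / (1 - x / 3) ^ 3 - x * Real.exp x) (fun x hx => ?_) fun x hx => ?_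
      · have hx1 : 1 - x / 3 ≠ 0 := by linarith [hx.2]
        have hx3 : 3 - x ≠ 0 := by linarith [hx.2]
        refine HasDerivAt.sub ?_ (hψ x)
        refine ((((hasDerivAt_id x).div (((hasDerivAt_id x).div_const 3).const_sub 1)
          hx1).pow 2).const_mul (1 / 2 : ℝ)).congr_deriv ?_
        simp
        field_simp
        ring
      · have hx1 : 0 < 1 - x / 3 := by linarith [hx.2]
        have h1 : 1 - x / 3 ≤ Real.exp (-(x / 3)) := by linarith [Real.add_one_le_exp (-(x / 3))]
        have h2 : (1 - x / 3) ^ 3 ≤ Real.exp (-x) := by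
          calc _ ≤ Real.exp (-(x / 3)) ^ 3 := pow_le_pow_left₀ hx1.le h1 3
            _ = _ := by rw [← Real.exp_nat_mul]; congr 1; push_cast; ring
        have h3 : Real.exp x ≤ 1 / (1 - x / 3) ^ 3 := by
          rw [le_div_iff₀ (pow_pos hx1 3)]
          calc _ ≤ Real.exp x * Real.exp (-x) := by gcongr
            _ = 1 := by rw [← Real.exp_add]; simp
        have := mul_le_mul_of_nonneg_left h3 hx.1
        rw [mul_one_div] at this
        linarith
    have h1 := hm (a := 0) (b := z) ⟨le_rfl, by norm_num⟩ ⟨h, hz.trans_lt hB3⟩ h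
    simp at h1
    have h2 : (1 - z / 3)⁻¹ ≤ (1 - B / 3)⁻¹ := inv_anti₀ hB1 (by linarith)
    have h3 : 0 ≤ (1 - z / 3)⁻¹ := inv_nonneg.2 (by linarith)
    have h4 := mul_le_mul_of_nonneg_right (pow_le_pow_left₀ h3 h2 2) (sq_nonneg z)
    rw [div_pow, div_eq_mul_inv, ← inv_pow] at h1
    nlinarith

end Calculus

/-! ### Exponential moments and the entropy of an exponential. -/

section Moments

variable {α : Type*} [MeasurableSpace α] {μ : Measure α} {f : α → ℝ}

/-- The exponential moments `E[f ^ j * exp (t * f)]`. -/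
noncomputable def expMoment (μ : Measure α) (f : α → ℝ) (j : ℕ) (t : ℝ) : ℝ :=
  ∫ x, f x ^ j * Real.exp (t * f x) ∂μ

theorem BddMeas.expMoment_integrand (hf : BddMeas f) (j : ℕ) (t : ℝ) :
    BddMeas fun x => f x ^ j * Real.exp (t * f x) := (hf.pow j).mul (hf.const_mul t).exp

theorem expMoment_one_zero : expMoment μ f 1 0 = ∫ x, f x ∂μ := by simp [expMoment]

/-- Divided by `E[exp(t f)]`, the right side is `t ψ' - ψ` for the log-Laplace transform `ψ`; every
entropy bound is thus a differential inequality. -/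
theorem ent_exp_eq (t : ℝ) :
    ent μ (fun x => Real.exp (t * f x)) =
      t * expMoment μ f 1 t - expMoment μ f 0 t * Real.log (expMoment μ f 0 t) := by
  simp only [phiEnt, Real.log_exp, expMoment, pow_zero, one_mul, pow_one]
  rw [← integral_const_mul]
  congr 2
  ext x
  ring

theorem BddMeas.exists_le_exp (hf : BddMeas f) (t : ℝ) :
    ∃ c, 0 < c ∧ ∀ x, c ≤ Real.exp (t * f x) := by
  obtain ⟨C, hC⟩ := (hf.const_mul t).bdd
  exact ⟨Real.exp (-C), Real.exp_pos _, fun x => Real.exp_le_exp.2 (abs_le.1 (hC x)).1⟩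

variable [IsProbabilityMeasure μ]

theorem BddMeas.hasDerivAt_expMoment (hf : BddMeas f) (j : ℕ) (t : ℝ) :
    HasDerivAt (expMoment μ f j) (expMoment μ f (j + 1) t) t := by
  refine hasDerivAt_integral_pow_mul_exp_real ?_ j
  have : integrableExpSet f μ = Set.univ :=
    Set.eq_univ_of_forall fun s => (hf.const_mul s).exp.integrable μ
  simp [this]

theorem BddMeas.expMoment_zero_pos (hf : BddMeas f) (t : ℝ) : 0 < expMoment μ f 0 t := by
  simpa [expMoment] using integral_exp_pos ((hf.const_mul t).exp.integrable μ)

theorem expMoment_zero_zero : expMoment μ f 0 0 = 1 := by simp [expMoment]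

theorem BddMeas.hasDerivAt_log_expMoment (hf : BddMeas f) (t : ℝ) :
    HasDerivAt (fun t => Real.log (expMoment μ f 0 t))
      (expMoment μ f 1 t / expMoment μ f 0 t) t :=
  (hf.hasDerivAt_expMoment 0 t).log (hf.expMoment_zero_pos t).ne'

/-- Subadditivity of entropy for exponentials on a product space. -/
theorem ent_exp_pi_le {𝒳 : Type*} [MeasurableSpace 𝒳] {μ : Measure 𝒳} [IsProbabilityMeasure μ]
    {n : ℕ} {f : (Fin n → 𝒳) → ℝ} (hf : BddMeas f) (t : ℝ) :
    ent (Measure.pi fun _ : Fin n => μ) (fun x => Real.exp (t * f x)) ≤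
      ∑ k, ∫ x, ent μ (fun y => Real.exp (t * f (Function.update x k y)))
        ∂(Measure.pi fun _ : Fin n => μ) ∧
    ∀ k, BddMeas fun x => ent μ (fun y => Real.exp (t * f (Function.update x k y))) := by
  obtain ⟨C, hC⟩ := (hf.const_mul t).bdd
  have hI : ∀ x, Real.exp (t * f x) ∈ Set.Icc (Real.exp (-C)) (Real.exp C) := fun x =>
    ⟨Real.exp_le_exp.2 (abs_le.1 (hC x)).1, Real.exp_le_exp.2 (abs_le.1 (hC x)).2⟩
  have hD : HasDualEnt (fun z => z * Real.log z) (Real.exp (-C)) (Real.exp C) μ :=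
    hasDualEnt_mul_log (Real.exp_pos _)
  exact ⟨hD.phiEnt_pi_le (hf.const_mul t).exp hI, fun k =>
    hD.bddMeas_phiEnt μ ((hf.const_mul t).exp.update k) fun p => hI _⟩

end Moments

/-! ### Self-bounding functions. -/

section SelfBounding

variable {α : Type*} [MeasurableSpace α] {μ : Measure α} [IsProbabilityMeasure μ] {g : α → ℝ}

/-- Up to normalization this is the variance under the tilted law, written with two independent
copies. `BddMeas.expMoment_one_eq` puts the mean over the same weight on pairs, so a pointwise bound
of `(g x - g y)²` by `g x + g y` integrates to a bound of variance by mean. -/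
theorem BddMeas.expMoment_two_eq (hg : BddMeas g) (t : ℝ) :
    expMoment μ g 2 t * expMoment μ g 0 t - expMoment μ g 1 t ^ 2 =
      1 / 2 * ∫ p, (g p.1 - g p.2) ^ 2 * (Real.exp (t * g p.1) * Real.exp (t * g p.2))
        ∂(μ.prod μ) := by
  have h : ∀ i j, BddMeas fun p : α × α =>
      (g p.1 ^ i * Real.exp (t * g p.1)) * (g p.2 ^ j * Real.exp (t * g p.2)) := fun i j =>
    ((hg.expMoment_integrand i t).comp measurable_fst).mul
      ((hg.expMoment_integrand j t).comp measurable_snd)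
  have hm : ∀ i j, ∫ p, (g p.1 ^ i * Real.exp (t * g p.1)) * (g p.2 ^ j * Real.exp (t * g p.2))
      ∂(μ.prod μ) = expMoment μ g i t * expMoment μ g j t := fun i j =>
    integral_prod_mul (fun x => g x ^ i * Real.exp (t * g x)) fun x => g x ^ j * Real.exp (t * g x)
  have he : ∀ p : α × α, (g p.1 - g p.2) ^ 2 * (Real.exp (t * g p.1) * Real.exp (t * g p.2)) =
      ((g p.1 ^ 2 * Real.exp (t * g p.1)) * (g p.2 ^ 0 * Real.exp (t * g p.2)) +
        (g p.1 ^ 0 * Real.exp (t * g p.1)) * (g p.2 ^ 2 * Real.exp (t * g p.2))) -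
      2 * ((g p.1 ^ 1 * Real.exp (t * g p.1)) * (g p.2 ^ 1 * Real.exp (t * g p.2))) :=
    fun p => by ring
  simp only [he]
  rw [integral_sub (((h 2 0).add (h 0 2)).integrable _) (((h 1 1).const_mul 2).integrable _),
    integral_add ((h 2 0).integrable _) ((h 0 2).integrable _), integral_const_mul, hm, hm, hm]
  ring

theorem BddMeas.expMoment_one_eq (hg : BddMeas g) (t : ℝ) :
    2 * (expMoment μ g 1 t * expMoment μ g 0 t) =
      ∫ p, (g p.1 + g p.2) * (Real.exp (t * g p.1) * Real.exp (t * g p.2)) ∂(μ.prod μ) := by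
  have h : ∀ i j, BddMeas fun p : α × α =>
      (g p.1 ^ i * Real.exp (t * g p.1)) * (g p.2 ^ j * Real.exp (t * g p.2)) := fun i j =>
    ((hg.expMoment_integrand i t).comp measurable_fst).mul
      ((hg.expMoment_integrand j t).comp measurable_snd)
  have hm : ∀ i j, ∫ p, (g p.1 ^ i * Real.exp (t * g p.1)) * (g p.2 ^ j * Real.exp (t * g p.2))
      ∂(μ.prod μ) = expMoment μ g i t * expMoment μ g j t := fun i j =>
    integral_prod_mul (fun x => g x ^ i * Real.exp (t * g x)) fun x => g x ^ j * Real.exp (t * g x)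
  have he : ∀ p : α × α, (g p.1 + g p.2) * (Real.exp (t * g p.1) * Real.exp (t * g p.2)) =
      (g p.1 ^ 1 * Real.exp (t * g p.1)) * (g p.2 ^ 0 * Real.exp (t * g p.2)) +
        (g p.1 ^ 0 * Real.exp (t * g p.1)) * (g p.2 ^ 1 * Real.exp (t * g p.2)) :=
    fun p => by ring
  simp only [he]
  rw [integral_add ((h 1 0).integrable _) ((h 0 1).integrable _), hm, hm]
  ring

/-- Entropy bound for a function whose square root has oscillation at most `√r`. -/
theorem ent_exp_le_of_sq_sub_le (hg : BddMeas g) {r : ℝ}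
    (hr : 0 ≤ r) (h : ∀ x y, (g x - g y) ^ 2 ≤ 2 * r * (g x + g y)) {t : ℝ} (ht : 0 ≤ t) :
    ent μ (fun x => Real.exp (t * g x)) ≤ t ^ 2 * r * expMoment μ g 1 t := by
  set M := expMoment μ g
  have hpos : ∀ s, 0 < M 0 s := hg.expMoment_zero_pos
  have hB : BddMeas fun p : α × α => g p.1 := hg.comp measurable_fst
  have hB' : BddMeas fun p : α × α => g p.2 := hg.comp measurable_snd
  have hvar0 : ∀ s, 0 ≤ M 2 s * M 0 s - M 1 s ^ 2 := fun s => by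
    rw [hg.expMoment_two_eq s]
    exact mul_nonneg (by norm_num) (integral_nonneg fun p => by positivity)
  have hvar : ∀ s, M 2 s * M 0 s - M 1 s ^ 2 ≤ 2 * r * (M 1 s * M 0 s) := fun s => by
    have hE : BddMeas fun p : α × α => Real.exp (s * g p.1) * Real.exp (s * g p.2) :=
      (hB.const_mul s).exp.mul (hB'.const_mul s).exp
    have := integral_mono (μ := μ.prod μ) ((((hB.sub hB').pow 2).mul hE).integrable _)
      ((((hB.add hB').mul hE).const_mul (2 * r)).integrable _) fun p => by
        have := mul_le_mul_of_nonneg_right (h p.1 p.2)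
          (mul_pos (Real.exp_pos (s * g p.1)) (Real.exp_pos (s * g p.2))).le
        simp only
        linarith
    rw [integral_const_mul, ← hg.expMoment_one_eq s] at this
    rw [hg.expMoment_two_eq s]
    linarith
  have hG' : ∀ s, HasDerivAt (fun s => M 1 s / M 0 s)
      ((M 2 s * M 0 s - M 1 s ^ 2) / M 0 s ^ 2) s := fun s =>
    ((hg.hasDerivAt_expMoment 1 s).div (hg.hasDerivAt_expMoment 0 s) (hpos s).ne').congr_deriv
      (by simp only [M]; ring)
  have hG : ∀ s, HasDerivAt (fun s => Real.log (M 0 s)) (M 1 s / M 0 s) s :=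
    hg.hasDerivAt_log_expMoment
  -- With `G = M 1 / M 0` the tilted mean, `hvar0` and `hvar` say `0 ≤ G' ≤ 2 r G`. The function
  -- vanishes at `0` and has derivative `s (2 r G - G') + r s² G' ≥ 0`. Its nonnegativity at `t`,
  -- multiplied by `M 0 t`, is the claim.
  have hmono : MonotoneOn (fun s => (Real.log (M 0 s) + r * s ^ 2 * (M 1 s / M 0 s)) -
      s * (M 1 s / M 0 s)) (Set.Ici 0) := by
    refine monotoneOn_of_hasDerivAt_nonneg (convex_Ici 0) (f' := fun s =>
      s * (2 * r * (M 1 s / M 0 s) - (M 2 s * M 0 s - M 1 s ^ 2) / M 0 s ^ 2) +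
        r * s ^ 2 * ((M 2 s * M 0 s - M 1 s ^ 2) / M 0 s ^ 2)) (fun s _ => ?_) fun s hs => ?_
    · refine (((hG s).add (((hasDerivAt_pow 2 s).const_mul r).mul (hG' s))).sub
        ((hasDerivAt_id s).mul (hG' s))).congr_deriv ?_
      simp only [id]
      push_cast
      ring
    · have h1 : (M 2 s * M 0 s - M 1 s ^ 2) / M 0 s ^ 2 ≤ 2 * r * (M 1 s / M 0 s) := by
        rw [div_le_iff₀ (pow_pos (hpos s) 2)]
        calc _ ≤ _ := hvar s
          _ = _ := by field_simp [(hpos s).ne']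
      have h2 := div_nonneg (hvar0 s) (sq_nonneg (M 0 s))
      exact add_nonneg (mul_nonneg hs (sub_nonneg.2 h1))
        (mul_nonneg (mul_nonneg hr (sq_nonneg s)) h2)
  have h1 := hmono (a := 0) (b := t) (by simp) ht ht
  have h00 : M 0 0 = 1 := expMoment_zero_zero
  simp only [h00, Real.log_one] at h1
  rw [ent_exp_eq]
  have h2 := mul_le_mul_of_nonneg_left h1 (hpos t).le
  have h3 : M 0 t * (M 1 t / M 0 t) = M 1 t := mul_div_cancel₀ _ (hpos t).ne'
  have h4 : M 0 t * ((Real.log (M 0 t) + r * t ^ 2 * (M 1 t / M 0 t)) - t * (M 1 t / M 0 t)) =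
      M 0 t * Real.log (M 0 t) + r * t ^ 2 * M 1 t - t * M 1 t := by
    rw [← h3]; field_simp [(hpos t).ne']
  rw [h4] at h2
  simp at h2
  simp only [M] at h2 ⊢
  linarith

end SelfBounding

section Product

variable {𝒳 : Type*} [MeasurableSpace 𝒳] {μ : Measure 𝒳} [IsProbabilityMeasure μ] {n : ℕ}

/-- Exponential moment bound for self-bounding functions. -/
theorem log_expMoment_le_of_sq_sub_le {g : (Fin n → 𝒳) → ℝ} (hg : BddMeas g) (hg0 : ∀ x, 0 ≤ g x)
    {r R : ℝ} (hr : 0 ≤ r) (hR : n * r ≤ R)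
    (h : ∀ x k y, (g x - g (Function.update x k y)) ^ 2 ≤
      2 * r * (g x + g (Function.update x k y))) {t : ℝ} (ht : 0 < t) (htR : R * t < 1) :
    Real.log (expMoment (Measure.pi fun _ : Fin n => μ) g 0 t) ≤
      t * (∫ x, g x ∂(Measure.pi fun _ : Fin n => μ)) / (1 - R * t) := by
  set P := Measure.pi fun _ : Fin n => μ
  set M := expMoment P g
  set e := ∫ x, g x ∂P
  have hpos : ∀ s, 0 < M 0 s := hg.expMoment_zero_pos
  have hent : ∀ s, 0 ≤ s → s * M 1 s - M 0 s * Real.log (M 0 s) ≤ R * s ^ 2 * M 1 s := by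
    intro s hs
    obtain ⟨h1, h2⟩ := ent_exp_pi_le (μ := μ) hg s
    rw [ent_exp_eq] at h1
    have h3 := hg.expMoment_integrand 1 s
    refine h1.trans ?_
    calc _ ≤ ∑ k : Fin n, s ^ 2 * r * M 1 s := by
          refine Finset.sum_le_sum fun k _ => ?_
          rw [show M 1 s = ∫ x, ∫ y, g (Function.update x k y) ^ 1 *
            Real.exp (s * g (Function.update x k y)) ∂μ ∂P from (integral_update μ h3 k).symm,
            ← integral_const_mul]
          refine integral_mono ((h2 k).integrable _)
            ((((h3.update k).integral_right μ).const_mul _).integrable _) fun x => ?_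
          refine ent_exp_le_of_sq_sub_le (g := fun y => g (Function.update x k y))
            (hg.update_right k x) hr (fun y y' => ?_) hs
          simpa using h (Function.update x k y) k y'
      _ = n * r * (s ^ 2 * M 1 s) := by simp; ring
      _ ≤ R * (s ^ 2 * M 1 s) := mul_le_mul_of_nonneg_right hR
          (mul_nonneg (sq_nonneg s) (integral_nonneg fun x =>
            mul_nonneg (pow_nonneg (hg0 x) 1) (Real.exp_pos _).le))
      _ = _ := by ring
  have hR0 : 0 ≤ R := le_trans (by positivity) hR
  have hG : ∀ s, HasDerivAt (fun s => Real.log (M 0 s)) (M 1 s / M 0 s) s :=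
    hg.hasDerivAt_log_expMoment
  have h00 : M 0 0 = 1 := expMoment_zero_zero
  have h10 : M 1 0 = e := expMoment_one_zero
  -- For this `H`, `s H' - H = s ψ' - ψ - R s² ψ'` with `ψ = log (M 0)`, so Herbst's hypothesis is
  -- `hent` divided by `M 0 s`.
  have hH : ∀ s, HasDerivAt (fun s => Real.log (M 0 s) * (1 - R * s) - s * e)
      (M 1 s / M 0 s * (1 - R * s) - R * Real.log (M 0 s) - e) s := fun s => by
    refine (((hG s).mul (((hasDerivAt_id s).const_mul R).const_sub 1)).sub
      ((hasDerivAt_id s).mul_const e)).congr_deriv ?_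
    simp only [id]
    ring
  have := nonpos_of_mul_deriv_le (L := t + 1) (x := t) (by simp [h00])
    ((hH 0).congr_deriv (by simp [h00, h10])) (fun s _ => hH s) (fun s hs => ?_)
    ⟨ht, by linarith⟩
  · rw [le_div_iff₀ (by linarith)]
    linarith
  · have h1 := hent s hs.1.le
    have h3 : M 0 s * (M 1 s / M 0 s) = M 1 s := mul_div_cancel₀ _ (hpos s).ne'
    rw [← h3] at h1
    have h4 : M 0 s * (s * (M 1 s / M 0 s) - Real.log (M 0 s)) ≤
        M 0 s * (R * s ^ 2 * (M 1 s / M 0 s)) := by linarith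
    have h5 := le_of_mul_le_mul_left h4 (hpos s)
    linarith

end Product

/-! ### Bennett-type entropy bound in one variable. -/

section OneVariable

variable {α : Type*} [MeasurableSpace α] {μ : Measure α} [IsProbabilityMeasure μ] {h : α → ℝ}

/-- The factor in front of the variance in the Bennett-type entropy bound. -/
noncomputable def bennettFactor (b t : ℝ) : ℝ := 1 / 2 * (1 - t * b / 3)⁻¹ ^ 2 * t ^ 2

theorem bennettFactor_nonneg (b t : ℝ) : 0 ≤ bennettFactor b t := by
  unfold bennettFactor; positivity

theorem phiEnt_sq_nonneg (hh : BddMeas h) : 0 ≤ phiEnt (· ^ 2) μ h := by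
  rw [phiEnt_sq_eq hh]
  exact integral_nonneg fun x => sq_nonneg _

/-- Entropy is at most the divergence to the constant `exp(t E[h])`, whose integrand is `exp(t E[h])
(z exp z - exp z + 1)` with `z = t (h - E[h]) ≤ t b`. Jensen then replaces `exp(t E[h])` by `E[exp(t
h)]`. -/
theorem ent_exp_le_bennett (hh : BddMeas h) {b t : ℝ} (hb : 0 ≤ b) (ht : 0 ≤ t)
    (htb : t * b < 3) (hhb : ∀ x, h x - ∫ y, h y ∂μ ≤ b) :
    ent μ (fun x => Real.exp (t * h x)) ≤
      bennettFactor b t * ((∫ x, Real.exp (t * h x) ∂μ) * phiEnt (· ^ 2) μ h) := by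
  set e := ∫ y, h y ∂μ
  obtain ⟨c, hc, hcx⟩ := hh.exists_le_exp t
  have hE : BddMeas fun x => Real.exp (t * h x) := (hh.const_mul t).exp
  have hd : BddMeas fun x => h x - e := hh.sub (.const _)
  have hmul : ∀ x, Real.exp (t * h x) = Real.exp (t * e) * Real.exp (t * (h x - e)) := fun x => by
    rw [← Real.exp_add]; congr 1; ring
  have hJ : Real.exp (t * e) ≤ ∫ x, Real.exp (t * h x) ∂μ := by
    have h0 : ∫ x, (h x - e) ∂μ = 0 := by
      rw [integral_sub (hh.integrable μ) (integrable_const _)]; simp [e]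
    calc Real.exp (t * e) = ∫ x, (Real.exp (t * e) + Real.exp (t * e) * t * (h x - e)) ∂μ := by
          rw [integral_add (integrable_const _) ((hd.const_mul _).integrable μ),
            integral_const_mul, h0]
          simp
      _ ≤ _ := by
          refine integral_mono (((BddMeas.const _).add (hd.const_mul _)).integrable μ)
            (hE.integrable μ) fun x => ?_
          simp only
          rw [hmul x]
          nlinarith [Real.add_one_le_exp (t * (h x - e)), Real.exp_pos (t * e)]
  calc ent μ (fun x => Real.exp (t * h x)) ≤ _ := ent_le hc (Real.exp_pos (t * e)) hE hcx
    _ ≤ ∫ x, Real.exp (t * e) * bennettFactor b t * (h x - e) ^ 2 ∂μ := by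
        have hl : BddMeas fun x => Real.log (Real.exp (t * h x)) := hE.log hc hcx
        refine integral_mono ((((hE.mul (hl.sub (.const _))).sub hE).add (.const _)).integrable μ)
          (((hd.pow 2).const_mul _).integrable μ) fun x => ?_
        have := mul_exp_sub_exp_add_one_le (z := t * (h x - e)) (B := t * b) (by positivity) htb
          (mul_le_mul_of_nonneg_left (hhb x) ht)
        have := mul_le_mul_of_nonneg_left this (Real.exp_pos (t * e)).le
        simp only [Real.log_exp, bennettFactor]
        rw [hmul x]
        linarith
    _ = bennettFactor b t * (Real.exp (t * e) * phiEnt (· ^ 2) μ h) := by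
        rw [integral_const_mul, phiEnt_sq_eq hh]; ring
    _ ≤ _ := mul_le_mul_of_nonneg_left (mul_le_mul_of_nonneg_right hJ (phiEnt_sq_nonneg hh))
        (bennettFactor_nonneg b t)

end OneVariable

/-! ### Bernstein inequality for functions of independent variables. -/

section Product

variable {𝒳 : Type*} [MeasurableSpace 𝒳] {n : ℕ}

/-- The sum of the conditional variances of `f` in each of its arguments. -/
noncomputable def sumVar (μ : Measure 𝒳) (f : (Fin n → 𝒳) → ℝ) (x : Fin n → 𝒳) : ℝ :=
  ∑ k, phiEnt (· ^ 2) μ fun y => f (Function.update x k y)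

variable {μ : Measure 𝒳} [IsProbabilityMeasure μ] {f : (Fin n → 𝒳) → ℝ}

theorem BddMeas.phiEnt_update (hf : BddMeas f) (k : Fin n) :
    BddMeas fun x => phiEnt (· ^ 2) μ fun y => f (Function.update x k y) := by
  obtain ⟨C, hC⟩ := hf.bdd
  exact (hasDualEnt_sq (μ := μ) (-C) C).bddMeas_phiEnt μ (hf.update k)
    fun p => abs_le.1 (hC _)

theorem BddMeas.sumVar (hf : BddMeas f) : BddMeas (sumVar μ f) :=
  BddMeas.sum _ fun k _ => hf.phiEnt_update k

theorem sumVar_nonneg (hf : BddMeas f) (x : Fin n → 𝒳) : 0 ≤ sumVar μ f x :=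
  Finset.sum_nonneg fun k _ => phiEnt_sq_nonneg (hf.update_right k x)

/-- The Efron-Stein inequality. -/
theorem phiEnt_sq_le_integral_sumVar (hf : BddMeas f) :
    phiEnt (· ^ 2) (Measure.pi fun _ : Fin n => μ) f ≤
      ∫ x, sumVar μ f x ∂(Measure.pi fun _ : Fin n => μ) := by
  obtain ⟨C, hC⟩ := hf.bdd
  have := (hasDualEnt_sq (μ := μ) (-C) C).phiEnt_pi_le hf fun x => abs_le.1 (hC _)
  simp only [sumVar]
  rwa [integral_finsetSum _ fun k _ => (hf.phiEnt_update k).integrable _]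

theorem ent_exp_pi_le_bennett (hf : BddMeas f) {b t : ℝ} (hb : 0 ≤ b) (ht : 0 ≤ t)
    (htb : t * b < 3) (hfb : ∀ x k y, f x - f (Function.update x k y) ≤ b) :
    ent (Measure.pi fun _ : Fin n => μ) (fun x => Real.exp (t * f x)) ≤
      bennettFactor b t *
        ∫ x, Real.exp (t * f x) * sumVar μ f x ∂(Measure.pi fun _ : Fin n => μ) := by
  obtain ⟨h1, h2⟩ := ent_exp_pi_le (μ := μ) hf t
  have hE : BddMeas fun x => Real.exp (t * f x) := (hf.const_mul t).exp
  have hEV : ∀ k, BddMeas fun x => Real.exp (t * f x) *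
      phiEnt (· ^ 2) μ fun y => f (Function.update x k y) := fun k => hE.mul (hf.phiEnt_update k)
  refine h1.trans ?_
  simp only [sumVar, Finset.mul_sum]
  rw [integral_finsetSum _ fun k _ => (hEV k).integrable _, Finset.mul_sum]
  refine Finset.sum_le_sum fun k _ => ?_
  -- The `k`-th conditional variance does not depend on the `k`-th coordinate, so after resampling
  -- that coordinate it leaves the inner integral as a factor.
  rw [← integral_update μ (hEV k) k, ← integral_const_mul]
  refine integral_mono ((h2 k).integrable _)
    (((((hEV k).update k).integral_right μ).const_mul _).integrable _) fun x => ?_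
  simp only [Function.update_idem]
  rw [integral_mul_const]
  have hx := hf.update_right k x
  refine ent_exp_le_bennett hx hb ht htb fun y => ?_
  have := integral_mono (((BddMeas.const (f (Function.update x k y))).sub hx).integrable μ)
    (integrable_const b) fun y' => by
      simpa using hfb (Function.update x k y) k y'
  rw [integral_sub (integrable_const _) (hx.integrable μ)] at this
  simpa using this

/-- The optimization over `θ`: here `S` stands for the normalized entropy, `T` for the tilted mean
of `V`, and `ρ²` for `R`. -/
theorem mul_sq_le_of_forall {S T a ρ v : ℝ} (ha : 0 < a) (hρ : 0 ≤ ρ) (haρ : a * ρ < 1)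
    (hv : 0 ≤ v) (hS : S ≤ a ^ 2 * T)
    (hT : ∀ θ, 0 < θ → ρ ^ 2 * θ < 1 → θ * T ≤ S + θ * v / (1 - ρ ^ 2 * θ)) :
    S * (1 - a * ρ) ^ 2 ≤ a ^ 2 * v := by
  rcases hρ.eq_or_lt with rfl | hρ
  · by_contra hc
    have hc' : a ^ 2 * v < S := by simpa using hc
    have hS0 : 0 < S := lt_of_le_of_lt (by positivity) hc'
    -- For `ρ = 0` every `θ > 0` is allowed and the bounds combine to `θ (S - a² v) ≤ a² S`; this
    -- `θ` makes the left side twice the right side.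
    set θ := 2 * a ^ 2 * S / (S - a ^ 2 * v) with hθ
    have hd : 0 < S - a ^ 2 * v := by linarith
    have hθ0 : 0 < θ := by positivity
    have h1 := hT θ hθ0 (by simp)
    have h2 : θ * (S - a ^ 2 * v) = 2 * a ^ 2 * S := div_mul_cancel₀ _ hd.ne'
    simp at h1
    have h3 := mul_le_mul_of_nonneg_left hS hθ0.le
    have h4 := mul_le_mul_of_nonneg_left h1 (sq_nonneg a)
    have : 0 < a ^ 2 * S := by positivity
    nlinarith
  · have hθ0 : 0 < a / ρ := div_pos ha hρ
    have he : ρ ^ 2 * (a / ρ) = a * ρ := by field_simp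
    have h1 := hT (a / ρ) hθ0 (by rwa [he])
    rw [he] at h1
    have hd : 0 < 1 - a * ρ := by linarith
    have h3 := mul_le_mul_of_nonneg_left hS hθ0.le
    have h4 := mul_le_mul_of_nonneg_left h1 (sq_nonneg a)
    have h5 : a / ρ * (S * (1 - a * ρ)) ≤ a / ρ * (a ^ 2 * v / (1 - a * ρ)) := by
      have : a / ρ * (S * (1 - a * ρ)) = a / ρ * S - a ^ 2 * S := by field_simp
      rw [this]
      have : a / ρ * (a ^ 2 * v / (1 - a * ρ)) = a ^ 2 * (a / ρ * v / (1 - a * ρ)) := by ring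
      rw [this]
      linarith
    have h6 := le_of_mul_le_mul_left h5 hθ0
    rw [le_div_iff₀ hd] at h6
    linarith

/-- Bound on the logarithmic moment generating function for functions of bounded interaction. -/
theorem log_expMoment_le_bernstein (hf : BddMeas f) {b : ℝ} (hb : 0 < b)
    (hfb : ∀ x k y, f x - f (Function.update x k y) ≤ b) {r R v : ℝ} (hr : 0 ≤ r)
    (hR : n * r ≤ R)
    (hV : ∀ x k y, (sumVar μ f x - sumVar μ f (Function.update x k y)) ^ 2 ≤
      2 * r * (sumVar μ f x + sumVar μ f (Function.update x k y)))
    (hv : ∫ x, sumVar μ f x ∂(Measure.pi fun _ : Fin n => μ) ≤ v)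
    {t : ℝ} (ht : 0 < t) (hct : (b / 3 + √(R / 2)) * t < 1) :
    Real.log (expMoment (Measure.pi fun _ : Fin n => μ) f 0 t) ≤
      t * (∫ x, f x ∂(Measure.pi fun _ : Fin n => μ)) +
        v * t ^ 2 / (2 * (1 - (b / 3 + √(R / 2)) * t)) := by
  set P := Measure.pi fun _ : Fin n => μ
  set c := b / 3 + √(R / 2) with hc
  set M := expMoment P f
  set e := ∫ x, f x ∂P
  have hVm : BddMeas (sumVar μ f) := hf.sumVar
  have hv0 : 0 ≤ v := (integral_nonneg (sumVar_nonneg hf)).trans hv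
  have hR0 : 0 ≤ R := le_trans (by positivity) hR
  have hcb : b / 3 ≤ c := le_add_of_nonneg_right (Real.sqrt_nonneg _)
  have hc0 : 0 < c := by linarith
  have hpos : ∀ s, 0 < M 0 s := hf.expMoment_zero_pos
  have hent : ∀ s, 0 < s → c * s < 1 →
      (s * (M 1 s / M 0 s) - Real.log (M 0 s)) ≤ v * s ^ 2 / (2 * (1 - c * s) ^ 2) := by
    intro s hs hcs
    have hsb : b / 3 * s < 1 := lt_of_le_of_lt (mul_le_mul_of_nonneg_right hcb hs.le) hcs
    have hd : 0 < 1 - s * b / 3 := by linarith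
    set S := s * (M 1 s / M 0 s) - Real.log (M 0 s)
    set I := ∫ x, Real.exp (s * f x) * sumVar μ f x ∂P
    have hentS : ent P (fun x => Real.exp (s * f x)) = M 0 s * S := by
      rw [ent_exp_eq]
      change s * M 1 s - M 0 s * Real.log (M 0 s) = _
      have := (hpos s).ne'
      simp only [S]
      field_simp
    have hbf : bennettFactor b s = (s / √2 * (1 - s * b / 3)⁻¹) ^ 2 := by
      rw [bennettFactor, mul_pow, div_pow, Real.sq_sqrt (by norm_num)]; ring
    have h1 : S ≤ (s / √2 * (1 - s * b / 3)⁻¹) ^ 2 * (I / M 0 s) := by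
      have := ent_exp_pi_le_bennett (μ := μ) hf hb.le hs.le (by linarith) hfb
      rw [hentS, hbf] at this
      rw [← mul_div_assoc, le_div_iff₀ (hpos s)]
      linarith
    have h2 : ∀ θ, 0 < θ → √R ^ 2 * θ < 1 →
        θ * (I / M 0 s) ≤ S + θ * v / (1 - √R ^ 2 * θ) := by
      intro θ hθ hRθ
      rw [Real.sq_sqrt hR0] at hRθ ⊢
      have h3 := log_expMoment_le_of_sq_sub_le (μ := μ) hVm (sumVar_nonneg hf) hr hR hV hθ hRθ
      have h4 : θ * (∫ x, sumVar μ f x ∂P) / (1 - R * θ) ≤ θ * v / (1 - R * θ) := by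
        have : 0 < 1 - R * θ := by linarith
        gcongr
      obtain ⟨c1, hc1, hc1x⟩ := hf.exists_le_exp s
      obtain ⟨d1, hd1, hd1x⟩ := hVm.exists_le_exp θ
      -- Decoupling: the variational formula with test function `exp(θ V)` gives `θ` times the
      -- tilted mean of `V` at most `S + log E[exp(θ V)]`.
      have h5 := le_ent (μ := P) hc1 hd1 (hf.const_mul s).exp hc1x (hVm.const_mul θ).exp hd1x
      rw [hentS] at h5
      set Lθ := Real.log (∫ y, Real.exp (θ * sumVar μ f y) ∂P) with hLθ
      have h6 : Lθ = Real.log (expMoment P (sumVar μ f) 0 θ) := by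
        simp [hLθ, expMoment]
      have h7 : ∫ x, Real.exp (s * f x) * (Real.log (Real.exp (θ * sumVar μ f x)) - Lθ) ∂P =
          θ * I - M 0 s * Lθ := by
        have hE : BddMeas fun x => Real.exp (s * f x) := (hf.const_mul s).exp
        have : ∀ x, Real.exp (s * f x) * (Real.log (Real.exp (θ * sumVar μ f x)) - Lθ) =
            θ * (Real.exp (s * f x) * sumVar μ f x) - Real.exp (s * f x) * Lθ := fun x => by
          rw [Real.log_exp]; ring
        simp only [this]
        rw [integral_sub (((hE.mul hVm).const_mul θ).integrable P)
          ((hE.mul (.const _)).integrable P), integral_const_mul, integral_mul_const]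
        simp [M, expMoment, I]
      rw [h7] at h5
      have h8 : θ * (I / M 0 s) ≤ S + Lθ := by
        rw [← mul_div_assoc, div_le_iff₀ (hpos s)]
        linarith
      rw [h6] at h8
      linarith
    -- This identity dictates `c = b / 3 + √(R / 2)`: the Bennett factors `(1 - s b / 3)⁻²` on the
    -- two sides cancel.
    have hcs' : 1 - s / √2 * (1 - s * b / 3)⁻¹ * √R = (1 - c * s) * (1 - s * b / 3)⁻¹ := by
      rw [hc, Real.sqrt_div hR0]
      linear_combination -mul_inv_cancel₀ hd.ne'
    have h9 := mul_sq_le_of_forall (a := s / √2 * (1 - s * b / 3)⁻¹) (ρ := √R) (by positivity)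
      (Real.sqrt_nonneg _) (by
        have : 0 < (1 - c * s) * (1 - s * b / 3)⁻¹ := mul_pos (by linarith) (inv_pos.2 hd)
        linarith) hv0 h1 h2
    rw [hcs', ← hbf, bennettFactor, mul_pow] at h9
    have h10 : 0 < (1 - s * b / 3)⁻¹ ^ 2 := by positivity
    have h11 : (1 - s * b / 3)⁻¹ ^ 2 * (S * (1 - c * s) ^ 2) ≤
        (1 - s * b / 3)⁻¹ ^ 2 * (1 / 2 * s ^ 2 * v) := by linarith
    have h12 := le_of_mul_le_mul_left h11 h10
    rw [le_div_iff₀ (by have : 0 < 1 - c * s := by linarith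
                        positivity)]
    linarith
  have hG : ∀ s, HasDerivAt (fun s => Real.log (M 0 s)) (M 1 s / M 0 s) s :=
    hf.hasDerivAt_log_expMoment
  have h00 : M 0 0 = 1 := expMoment_zero_zero
  have h10 : M 1 0 = e := expMoment_one_zero
  -- The subtracted term `B(s) = (v / 2) s² / (1 - c s)` satisfies `s B' - B = v s² / (2 (1 - c
  -- s)²)`, exactly the bound in `hent`.
  have hH : ∀ s, 1 - c * s ≠ 0 → HasDerivAt
      (fun s => Real.log (M 0 s) - s * e - v / 2 * (s ^ 2 / (1 - c * s)))
      (M 1 s / M 0 s - e - v / 2 * ((2 * s * (1 - c * s) + c * s ^ 2) / (1 - c * s) ^ 2)) s := by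
    intro s hs
    refine (((hG s).sub ((hasDerivAt_id s).mul_const e)).sub (((hasDerivAt_pow 2 s).div
      (((hasDerivAt_id s).const_mul c).const_sub 1) hs).const_mul (v / 2))).congr_deriv ?_
    simp only [id]
    push_cast
    ring
  have hL : ∀ s ∈ Set.Ioo 0 c⁻¹, 0 < 1 - c * s := fun s hs => by
    have := mul_lt_mul_of_pos_left hs.2 hc0
    rw [mul_inv_cancel₀ hc0.ne'] at this
    linarith
  have := nonpos_of_mul_deriv_le (L := c⁻¹) (x := t) (by simp [h00])
    ((hH 0 (by simp)).congr_deriv (by simp [h00, h10])) (fun s hs => hH s (hL s hs).ne')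
    (fun s hs => ?_) ⟨ht, by rwa [← one_div, lt_div_iff₀' hc0]⟩
  · have h1 : v * t ^ 2 / (2 * (1 - c * t)) = v / 2 * (t ^ 2 / (1 - c * t)) := by
      have : 1 - c * t ≠ 0 := by linarith
      field_simp
    rw [h1]
    linarith
  · have h1 := hent s hs.1 (by linarith [hL s hs])
    have h2 : s * (v / 2 * ((2 * s * (1 - c * s) + c * s ^ 2) / (1 - c * s) ^ 2)) -
        v / 2 * (s ^ 2 / (1 - c * s)) = v * s ^ 2 / (2 * (1 - c * s) ^ 2) := by
      have := (hL s hs).ne'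
      field_simp
      ring
    linarith

/-- A Bernstein-type inequality for functions of bounded interaction. -/
theorem measureReal_gt_le_bernstein (hf : BddMeas f) {b : ℝ} (hb : 0 < b)
    (hfb : ∀ x k y, f x - f (Function.update x k y) ≤ b) {r R v : ℝ} (hr : 0 ≤ r)
    (hR : n * r ≤ R)
    (hV : ∀ x k y, (sumVar μ f x - sumVar μ f (Function.update x k y)) ^ 2 ≤
      2 * r * (sumVar μ f x + sumVar μ f (Function.update x k y)))
    (hv : ∫ x, sumVar μ f x ∂(Measure.pi fun _ : Fin n => μ) ≤ v) {t : ℝ} (ht : 0 < t) :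
    (Measure.pi fun _ : Fin n => μ).real
        {x | f x - ∫ x, f x ∂(Measure.pi fun _ : Fin n => μ) > t} ≤
      Real.exp (-t ^ 2 / (2 * (v + (b / 3 + √(R / 2)) * t))) := by
  set P := Measure.pi fun _ : Fin n => μ
  set c := b / 3 + √(R / 2) with hc
  have hc0 : 0 < c := by positivity
  have hv0 : 0 ≤ v := (integral_nonneg (sumVar_nonneg hf)).trans hv
  -- If `v = 0`, the Chernoff parameter `t / (v + c t)` would be the excluded endpoint `1 / c`. A
  -- strict majorant `w` avoids this, and `w → v` follows by continuity.
  have key : ∀ w, v < w → P.real {x | f x - ∫ x, f x ∂P > t} ≤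
      Real.exp (-t ^ 2 / (2 * (w + c * t))) := by
    intro w hw
    have hw0 : 0 < w := hv0.trans_lt hw
    have hwt : 0 < w + c * t := by positivity
    set s := t / (w + c * t) with hs
    have hs0 : 0 < s := by positivity
    have hcs : 1 - c * s = w / (w + c * t) := by rw [hs]; field_simp; ring
    have hcs0 : 0 < w / (w + c * t) := by positivity
    have h1 := log_expMoment_le_bernstein hf hb hfb hr hR hV (hv.trans hw.le) hs0
      (by rw [← hc]; linarith)
    rw [← hc, hcs] at h1
    have h2 := measure_ge_le_exp_mul_mgf (μ := P) (X := f) (t + ∫ x, f x ∂P) hs0.le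
      ((hf.const_mul s).exp.integrable P)
    have h3 : mgf f P s = Real.exp (Real.log (expMoment P f 0 s)) := by
      rw [Real.exp_log (hf.expMoment_zero_pos s)]; simp [mgf, expMoment]
    refine (measureReal_mono (fun x hx => ?_)).trans (h2.trans ?_)
    · simp only [Set.mem_ofPred_eq] at hx ⊢
      linarith
    · rw [h3, ← Real.exp_add]
      refine Real.exp_le_exp.2 ?_
      have h4 : -s * t + w * s ^ 2 / (2 * (w / (w + c * t))) = -t ^ 2 / (2 * (w + c * t)) := by
        rw [hs]; field_simp; ring
      rw [← h4]
      linarith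
  have hcont : ContinuousAt (fun w => Real.exp (-t ^ 2 / (2 * (w + c * t)))) v := by
    refine Real.continuous_exp.continuousAt.comp (ContinuousAt.div continuousAt_const ?_ ?_)
    · fun_prop
    · have : 0 < v + c * t := by positivity
      positivity
  exact ge_of_tendsto (hcont.tendsto.mono_left (nhdsWithin_le_nhds (s := Set.Ioi v)))
    (Filter.eventually_of_mem self_mem_nhdsWithin key)

end Product

/-! ### Partial differences, their measurability, and coordinate selection. -/

section PartialDiff

variable {𝒳 : Type*} {m n : ℕ}

theorem partialDiff_comp_injective {e : Fin m → Fin n} (he : Function.Injective e) (i : Fin m)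
    (y y' : 𝒳) (G : (Fin m → 𝒳) → ℝ) :
    partialDiff (e i) y y' (fun x => G (x ∘ e)) = fun x => partialDiff i y y' G (x ∘ e) := by
  funext x
  simp only [partialDiff, Function.update_comp_eq_of_injective _ he]

theorem partialDiff_self (k : Fin n) (y y' z z' : 𝒳) (G : (Fin n → 𝒳) → ℝ) (x : Fin n → 𝒳) :
    partialDiff k z z' (partialDiff k y y' G) x = 0 := by
  simp [partialDiff]

theorem partialDiff_update_self (k : Fin n) (y y' z : 𝒳) (G : (Fin n → 𝒳) → ℝ) (x : Fin n → 𝒳) :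
    partialDiff k y y' G (Function.update x k z) = partialDiff k y y' G x := by
  simp [partialDiff]

theorem partialDiff_const_mul_sum {ι : Type*} (s : Finset ι) (c : ℝ) (k : Fin n) (y y' : 𝒳)
    (G : ι → (Fin n → 𝒳) → ℝ) :
    partialDiff k y y' (fun x => c * ∑ i ∈ s, G i x) =
      fun x => c * ∑ i ∈ s, partialDiff k y y' (G i) x := by
  funext x
  simp only [partialDiff, Finset.sum_sub_distrib]
  ring

theorem abs_partialDiff_le {G : (Fin n → 𝒳) → ℝ} {c : ℝ} (hG : ∀ x, |G x| ≤ c) (k : Fin n)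
    (y y' : 𝒳) (x : Fin n → 𝒳) : |partialDiff k y y' G x| ≤ 2 * c := by
  have h1 := hG (Function.update x k y)
  have h2 := hG (Function.update x k y')
  have := abs_sub (G (Function.update x k y)) (G (Function.update x k y'))
  simp only [partialDiff]
  linarith

end PartialDiff

section Measurability

variable {𝒳 α : Type*} [MeasurableSpace 𝒳] [MeasurableSpace α] {n : ℕ}

theorem measurable_update_comp {u : α → Fin n → 𝒳} {v : α → 𝒳} (hu : Measurable u)
    (hv : Measurable v) (k : Fin n) : Measurable fun a => Function.update (u a) k (v a) :=
  (measurable_update_prod k).comp (hu.prodMk hv)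

theorem BddMeas.partialDiff {G : (Fin n → 𝒳) → ℝ} (hG : BddMeas G) (k : Fin n) {u : α → Fin n → 𝒳}
    {v w : α → 𝒳} (hu : Measurable u) (hv : Measurable v) (hw : Measurable w) :
    BddMeas fun a => partialDiff k (v a) (w a) G (u a) :=
  (hG.comp (measurable_update_comp hu hv k)).sub (hG.comp (measurable_update_comp hu hw k))

theorem BddMeas.partialDiff_partialDiff {G : (Fin n → 𝒳) → ℝ} (hG : BddMeas G) (k l : Fin n)
    {u : α → Fin n → 𝒳} {v w v' w' : α → 𝒳} (hu : Measurable u) (hv : Measurable v)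
    (hw : Measurable w) (hv' : Measurable v') (hw' : Measurable w') :
    BddMeas fun a => UStat.partialDiff k (v a) (w a)
      (UStat.partialDiff l (v' a) (w' a) G) (u a) :=
  (hG.partialDiff l (measurable_update_comp hu hv k) hv' hw').sub
    (hG.partialDiff l (measurable_update_comp hu hw k) hv' hw')

/-- In this form, changing another coordinate of `x` changes the summands through mixed differences,
the quantities in `β` and `γ`. -/
theorem sumVar_eq {μ : Measure 𝒳} [IsProbabilityMeasure μ] {g : (Fin n → 𝒳) → ℝ} (hg : BddMeas g)
    (x : Fin n → 𝒳) :
    sumVar μ g x = ∑ k, 1 / 2 * ∫ p, (UStat.partialDiff k p.1 p.2 g x) ^ 2 ∂(μ.prod μ) :=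
  Finset.sum_congr rfl fun k _ => phiEnt_sq_eq_half (hg.update_right k x)

theorem measurePreserving_comp_injective {m : ℕ} (μ : Measure 𝒳) [IsProbabilityMeasure μ]
    {e : Fin m → Fin n} (he : Function.Injective e) :
    MeasurePreserving (fun x : Fin n → 𝒳 => x ∘ e) (Measure.pi fun _ : Fin n => μ)
      (Measure.pi fun _ : Fin m => μ) := by
  have hm : ∀ i : Fin n, Measurable fun x : Fin n → 𝒳 => x i := measurable_pi_apply
  refine ⟨measurable_pi_iff.2 fun j => hm _, ?_⟩
  have h := iIndepFun_pi (μ := fun _ : Fin n => μ) (X := fun _ => id)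
    fun _ => measurable_id.aemeasurable
  have h2 := (h.precomp he).map_fun_eq_pi_map fun j => (hm (e j)).aemeasurable
  refine h2.trans ?_
  congr 1
  funext j
  exact (measurePreserving_eval (fun _ : Fin n => μ) (e j)).map_eq

theorem integral_comp_injective {m : ℕ} (μ : Measure 𝒳) [IsProbabilityMeasure μ]
    {e : Fin m → Fin n} (he : Function.Injective e) {F : (Fin m → 𝒳) → ℝ} (hF : BddMeas F) :
    ∫ x, F (x ∘ e) ∂(Measure.pi fun _ : Fin n => μ) = ∫ x, F x ∂(Measure.pi fun _ : Fin m => μ) := by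
  have h := measurePreserving_comp_injective μ he
  rw [← h.map_eq, integral_map h.measurable.aemeasurable hF.meas.aestronglyMeasurable]

end Measurability

/-! ### Counting index sets through one or two given indices. -/

section Combinatorics

variable {m n : ℕ}

theorem exists_perm_apply_eq {i j a b : Fin m} (hab : a ≠ b) (hij : i ≠ j) :
    ∃ π : Equiv.Perm (Fin m), π a = i ∧ π b = j := by
  have h1 : Equiv.swap a i b ≠ i := by
    intro h
    apply hab
    apply (Equiv.swap a i).injective
    rw [h, Equiv.swap_apply_left]
  refine ⟨(Equiv.swap a i).trans (Equiv.swap (Equiv.swap a i b) j), ?_, ?_⟩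
  · rw [Equiv.trans_apply, Equiv.swap_apply_left, Equiv.swap_apply_of_ne_of_ne h1.symm hij]
  · rw [Equiv.trans_apply, Equiv.swap_apply_left]

theorem card_filter_subset (T : Finset (Fin n)) (hT : T.card ≤ m) :
    (Finset.univ.filter fun W : {W : Finset (Fin n) // W.card = m} => T ⊆ W.1).card =
      (n - T.card).choose (m - T.card) := by
  have : (n - T.card).choose (m - T.card) = (Finset.powersetCard (m - T.card) Tᶜ).card := by
    rw [Finset.card_powersetCard, Finset.card_compl, Fintype.card_fin]
  rw [this]
  refine Finset.card_bij (fun W _ => W.1 \ T) (fun W hW => ?_) (fun W hW W' hW' h => ?_)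
    fun S hS => ?_
  · simp only [Finset.mem_filter, Finset.mem_univ, true_and] at hW
    rw [Finset.mem_powersetCard, Finset.card_sdiff_of_subset hW, W.2]
    exact ⟨fun a ha => by simpa using (Finset.mem_sdiff.1 ha).2, rfl⟩
  · simp only [Finset.mem_filter, Finset.mem_univ, true_and] at hW hW'
    apply Subtype.ext
    rw [← Finset.sdiff_union_of_subset hW, h, Finset.sdiff_union_of_subset hW']
  · rw [Finset.mem_powersetCard] at hS
    have hd : Disjoint S T := by
      rw [Finset.disjoint_left]
      intro a ha
      simpa using hS.1 ha
    refine ⟨⟨S ∪ T, ?_⟩, by simp, ?_⟩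
    · rw [Finset.card_union_of_disjoint hd, hS.2]; omega
    · exact Finset.union_sdiff_cancel_right hd

theorem card_filter_mem_div (hm : 1 ≤ m) (hmn : m < n) (k : Fin n) :
    ((Finset.univ.filter fun W : {W : Finset (Fin n) // W.card = m} => k ∈ W.1).card : ℝ) *
      ((n.choose m : ℕ) : ℝ)⁻¹ = m / n := by
  have h := card_filter_subset {k} (m := m) (by simpa using hm)
  simp only [Finset.singleton_subset_iff, Finset.card_singleton] at h
  rw [h]
  obtain ⟨m, rfl⟩ := Nat.exists_eq_add_of_le' hm
  obtain ⟨n, rfl⟩ := Nat.exists_eq_add_of_le' (by omega : 1 ≤ n)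
  have hc : (((n + 1).choose (m + 1) : ℕ) : ℝ) ≠ 0 := by
    exact_mod_cast (Nat.choose_pos hmn.le).ne'
  have h2 : ((n + 1 : ℕ) : ℝ) * (n.choose m : ℕ) = ((n + 1).choose (m + 1) : ℕ) * (m + 1 : ℕ) := by
    exact_mod_cast Nat.add_one_mul_choose_eq n m
  have hn : ((n + 1 : ℕ) : ℝ) ≠ 0 := by positivity
  rw [← div_eq_mul_inv, div_eq_div_iff hc hn]
  simp only [Nat.add_sub_cancel]
  linarith

theorem card_filter_mem_mem_div (hm : 1 ≤ m) (hmn : m < n) {k l : Fin n} (hkl : k ≠ l) :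
    ((Finset.univ.filter fun W : {W : Finset (Fin n) // W.card = m} =>
      k ∈ W.1 ∧ l ∈ W.1).card : ℝ) * ((n.choose m : ℕ) : ℝ)⁻¹ = m * (m - 1) / (n * (n - 1)) := by
  have he : (Finset.univ.filter fun W : {W : Finset (Fin n) // W.card = m} =>
      k ∈ W.1 ∧ l ∈ W.1) = Finset.univ.filter fun W => {k, l} ⊆ W.1 := by
    ext W; simp [Finset.insert_subset_iff]
  rw [he]
  -- For `m = 1` no index set contains a pair and the factor `m - 1` vanishes, so the formula covers
  -- this case as well.
  rcases Nat.lt_or_ge m 2 with h1 | h2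
  · obtain rfl : m = 1 := by omega
    have : (Finset.univ.filter fun W : {W : Finset (Fin n) // W.card = 1} => {k, l} ⊆ W.1) = ∅ := by
      refine Finset.filter_eq_empty_iff.2 fun W _ hW => ?_
      have := Finset.card_le_card hW
      rw [Finset.card_pair hkl, W.2] at this
      omega
    rw [this]; simp
  · rw [card_filter_subset {k, l} (by rwa [Finset.card_pair hkl]), Finset.card_pair hkl]
    obtain ⟨m, rfl⟩ := Nat.exists_eq_add_of_le' h2
    obtain ⟨n, rfl⟩ := Nat.exists_eq_add_of_le' (by omega : 2 ≤ n)
    have hc : (((n + 2).choose (m + 2) : ℕ) : ℝ) ≠ 0 := by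
      exact_mod_cast (Nat.choose_pos hmn.le).ne'
    have h3 : ((n : ℝ) + 2) * ((n + 1).choose (m + 1) : ℕ) =
        ((n + 2).choose (m + 2) : ℕ) * (m + 2) := by
      exact_mod_cast Nat.add_one_mul_choose_eq (n + 1) (m + 1)
    have h4 : ((n : ℝ) + 1) * (n.choose m : ℕ) = ((n + 1).choose (m + 1) : ℕ) * (m + 1) := by
      exact_mod_cast Nat.add_one_mul_choose_eq n m
    simp only [Nat.add_sub_cancel]
    push_cast
    have h5 : ((n : ℝ) + 2) * (n + 2 - 1) ≠ 0 := by
      have : (n : ℝ) + 2 - 1 = n + 1 := by ring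
      rw [this]; positivity
    rw [← div_eq_mul_inv, div_eq_div_iff hc h5]
    linear_combination ((n : ℝ) + 2) * h4 + ((m : ℝ) + 1) * h3

end Combinatorics

/-! ### The kernel on an index set, and differences of the U-statistic. -/

section Kernel

variable {𝒳 : Type*} {m n : ℕ} {K : (Fin m → 𝒳) → ℝ}

/-- The kernel applied to the arguments with index in `W`. -/
def kernelOn (K : (Fin m → 𝒳) → ℝ) (W : {W : Finset (Fin n) // W.card = m}) (x : Fin n → 𝒳) : ℝ :=
  K fun j => x (W.1.orderEmbOfFin W.2 j)

theorem completeU_eq : completeU n K = fun x : Fin n → 𝒳 =>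
    ((n.choose m : ℕ) : ℝ)⁻¹ * ∑ W, kernelOn K W x := rfl

theorem kernelOn_update {W : {W : Finset (Fin n) // W.card = m}} {k : Fin n} (hk : k ∉ W.1)
    (x : Fin n → 𝒳) (y : 𝒳) : kernelOn K W (Function.update x k y) = kernelOn K W x := by
  unfold kernelOn
  congr 1
  funext j
  refine Function.update_of_ne (fun h => hk ?_) _ _
  rw [← h]
  exact Finset.orderEmbOfFin_mem _ _ _

theorem exists_orderEmbOfFin_eq (W : {W : Finset (Fin n) // W.card = m}) {k : Fin n}
    (hk : k ∈ W.1) : ∃ i, W.1.orderEmbOfFin W.2 i = k := by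
  have : k ∈ Set.range (W.1.orderEmbOfFin W.2) := by
    rw [Finset.range_orderEmbOfFin]; exact hk
  exact this

/-- Symmetry of `K` allows `k` to be listed first. The projection, `β` and `γ` are defined with the
first slots, so this and the two-index version reduce every index set to them. -/
theorem exists_kernelOn_eq
    (hK : ∀ (π : Equiv.Perm (Fin m)) (x : Fin m → 𝒳), K (fun j => x (π j)) = K x)
    (hm : 0 < m) (W : {W : Finset (Fin n) // W.card = m}) {k : Fin n}
    (hk : k ∈ W.1) : ∃ e : Fin m → Fin n, Function.Injective e ∧ e ⟨0, hm⟩ = k ∧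
      kernelOn K W = fun x => K (x ∘ e) := by
  obtain ⟨i, hi⟩ := exists_orderEmbOfFin_eq W hk
  refine ⟨fun j => W.1.orderEmbOfFin W.2 (Equiv.swap ⟨0, hm⟩ i j),
    (W.1.orderEmbOfFin W.2).injective.comp (Equiv.injective _), by simp [hi], ?_⟩
  funext x
  exact (hK (Equiv.swap ⟨0, hm⟩ i) fun j => x (W.1.orderEmbOfFin W.2 j)).symm

theorem exists_kernelOn_eq_pair
    (hK : ∀ (π : Equiv.Perm (Fin m)) (x : Fin m → 𝒳), K (fun j => x (π j)) = K x)
    (hm : 2 ≤ m) (W : {W : Finset (Fin n) // W.card = m})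
    {k l : Fin n} (hk : k ∈ W.1) (hl : l ∈ W.1) (hkl : k ≠ l) :
    ∃ e : Fin m → Fin n, Function.Injective e ∧ e ⟨0, by omega⟩ = k ∧ e ⟨1, by omega⟩ = l ∧
      kernelOn K W = fun x => K (x ∘ e) := by
  obtain ⟨i, hi⟩ := exists_orderEmbOfFin_eq W hk
  obtain ⟨j, hj⟩ := exists_orderEmbOfFin_eq W hl
  obtain ⟨π, h0, h1⟩ := exists_perm_apply_eq (a := (⟨0, by omega⟩ : Fin m)) (b := ⟨1, by omega⟩)
    (by simp) (show i ≠ j by rintro rfl; exact hkl (hi.symm.trans hj))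
  refine ⟨fun j => W.1.orderEmbOfFin W.2 (π j),
    (W.1.orderEmbOfFin W.2).injective.comp (Equiv.injective _), by simp [h0, hi],
    by simp [h1, hj], ?_⟩
  funext x
  exact (hK π fun j => x (W.1.orderEmbOfFin W.2 j)).symm

end Kernel

section KernelDiff

variable {𝒳 : Type*} {m n : ℕ} {K : (Fin m → 𝒳) → ℝ}

theorem partialDiff_completeU (k : Fin n) (y y' : 𝒳) :
    partialDiff k y y' (completeU n K) = fun x =>
      ((n.choose m : ℕ) : ℝ)⁻¹ * ∑ W, partialDiff k y y' (kernelOn K W) x := by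
  rw [completeU_eq, partialDiff_const_mul_sum]

theorem partialDiff_partialDiff_completeU (k l : Fin n) (z z' y y' : 𝒳) :
    partialDiff k z z' (partialDiff l y y' (completeU n K)) = fun x =>
      ((n.choose m : ℕ) : ℝ)⁻¹ *
        ∑ W, partialDiff k z z' (partialDiff l y y' (kernelOn K W)) x := by
  rw [partialDiff_completeU, partialDiff_const_mul_sum]

theorem partialDiff_kernelOn_of_notMem {W : {W : Finset (Fin n) // W.card = m}} {k : Fin n}
    (hk : k ∉ W.1) (y y' : 𝒳) (x : Fin n → 𝒳) : partialDiff k y y' (kernelOn K W) x = 0 := by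
  simp [partialDiff, kernelOn_update hk]

theorem partialDiff_partialDiff_kernelOn_of_not {W : {W : Finset (Fin n) // W.card = m}}
    {k l : Fin n} (hkl : k ≠ l) (h : ¬(k ∈ W.1 ∧ l ∈ W.1)) (z z' y y' : 𝒳) (x : Fin n → 𝒳) :
    partialDiff k z z' (partialDiff l y y' (kernelOn K W)) x = 0 := by
  by_cases hl : l ∈ W.1
  · have hk : k ∉ W.1 := fun hk => h ⟨hk, hl⟩
    simp [partialDiff, Function.update_comm hkl, kernelOn_update hk]
  · simp [partialDiff, kernelOn_update hl]

/-- Cauchy-Schwarz over the nonvanishing terms only. In the applications `c` is the inverse binomial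
coefficient, so `s.card * c` is the proportion of index sets containing the given pair. -/
theorem integral_sq_avg_le {Ω ι : Type*} [MeasurableSpace Ω] [Fintype ι] (Q : Measure Ω)
    [IsProbabilityMeasure Q] (s : Finset ι) {a : ι → Ω → ℝ} (ha : ∀ i, BddMeas (a i)) {B : ℝ}
    (hB : ∀ i ∈ s, ∫ ω, a i ω ^ 2 ∂Q ≤ B) (h0 : ∀ i ∉ s, ∀ ω, a i ω = 0) (c : ℝ) :
    ∫ ω, (c * ∑ i, a i ω) ^ 2 ∂Q ≤ (s.card * c) ^ 2 * B := by
  have hs : ∀ ω, ∑ i, a i ω = ∑ i ∈ s, a i ω := fun ω =>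
    (Finset.sum_subset (Finset.subset_univ s) fun i _ hi => h0 i hi ω).symm
  have h1 : ∀ i ∈ s, BddMeas fun ω => a i ω ^ 2 := fun i _ => (ha i).pow 2
  simp only [hs]
  calc _ ≤ ∫ ω, c ^ 2 * s.card * ∑ i ∈ s, a i ω ^ 2 ∂Q := by
        refine integral_mono ((((BddMeas.sum s fun i _ => ha i).const_mul c).pow 2).integrable Q)
          (((BddMeas.sum s h1).const_mul _).integrable Q) fun ω => ?_
        simp only [mul_pow, mul_assoc]
        exact mul_le_mul_of_nonneg_left sq_sum_le_card_mul_sum_sq (sq_nonneg c)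
    _ = c ^ 2 * s.card * ∑ i ∈ s, ∫ ω, a i ω ^ 2 ∂Q := by
        rw [integral_const_mul, integral_finsetSum _ fun i hi => (h1 i hi).integrable Q]
    _ ≤ c ^ 2 * s.card * ∑ i ∈ s, B := by gcongr with i hi; exact hB i hi
    _ = _ := by simp; ring

end KernelDiff

theorem gamma_nonneg {𝒳 : Type*} [MeasurableSpace 𝒳] {m : ℕ} {μ : Measure 𝒳}
    {K : (Fin m → 𝒳) → ℝ} : 0 ≤ gamma μ K := by
  unfold gamma
  split_ifs
  · exact Real.iSup_nonneg fun q => integral_nonneg fun p => sq_nonneg _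
  · exact le_rfl

theorem beta_nonneg {𝒳 : Type*} [MeasurableSpace 𝒳] {m : ℕ} {μ : Measure 𝒳}
    {K : (Fin m → 𝒳) → ℝ} : 0 ≤ beta μ K := by
  unfold beta
  split_ifs
  · exact integral_nonneg fun p => sq_nonneg _
  · exact le_rfl

variable {𝒳 : Type*} [MeasurableSpace 𝒳] {m n : ℕ} {μ : Measure 𝒳} [IsProbabilityMeasure μ]
  {K : (Fin m → 𝒳) → ℝ}

/-! ### The interaction quantities `β` and `γ`. -/

section BetaGamma

theorem integral_partialDiff_sq_le_gamma (hKm : Measurable K) (hK : ∀ x, |K x| ≤ 1) (h : 2 ≤ m)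
    (x : Fin m → 𝒳) (z z' : 𝒳) :
    ∫ p : 𝒳 × 𝒳, (partialDiff ⟨0, by omega⟩ z z' (partialDiff ⟨1, by omega⟩ p.1 p.2 K) x) ^ 2
      ∂(μ.prod μ) ≤ gamma μ K := by
  have hB : BddMeas K := ⟨hKm, 1, hK⟩
  rw [gamma, dif_pos h]
  -- The range must be bounded, since an unbounded real supremum is `0` by convention. Mixed
  -- differences of `K` are at most `4` in absolute value, whence `16`.
  refine le_ciSup (f := fun q : (Fin m → 𝒳) × 𝒳 × 𝒳 => ∫ p : 𝒳 × 𝒳,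
    (partialDiff ⟨0, by omega⟩ q.2.1 q.2.2 (partialDiff ⟨1, by omega⟩ p.1 p.2 K) q.1) ^ 2
      ∂(μ.prod μ)) ⟨16, ?_⟩ (x, z, z')
  rintro _ ⟨q, rfl⟩
  have hI : BddMeas fun p : 𝒳 × 𝒳 => (partialDiff ⟨0, by omega⟩ q.2.1 q.2.2
      (partialDiff ⟨1, by omega⟩ p.1 p.2 K) q.1) ^ 2 :=
    (hB.partialDiff_partialDiff (⟨0, by omega⟩ : Fin m) ⟨1, by omega⟩ measurable_const
      measurable_const measurable_const measurable_fst measurable_snd).pow 2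
  have := integral_mono (hI.integrable (μ.prod μ)) (integrable_const 16) fun p => by
    have h1 := abs_partialDiff_le (abs_partialDiff_le hK (⟨1, by omega⟩ : Fin m) p.1 p.2)
      ⟨0, by omega⟩ q.2.1 q.2.2 q.1
    have h2 := pow_le_pow_left₀ (abs_nonneg _) h1 2
    rw [sq_abs] at h2
    exact h2.trans (by norm_num)
  simpa using this

/-- The mixed difference ignores slots `0` and `1` of its base point, so the sample coordinates
substituted there may be replaced by fresh independent variables. -/
theorem beta_eq (hB : BddMeas K) (h : 2 ≤ m) :
    beta μ K = ∫ r : (Fin m → 𝒳) × (𝒳 × 𝒳) × (𝒳 × 𝒳),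
      (partialDiff ⟨0, by omega⟩ r.2.1.1 r.2.1.2
        (partialDiff ⟨1, by omega⟩ r.2.2.1 r.2.2.2 K) r.1) ^ 2
      ∂((Measure.pi fun _ : Fin m => μ).prod ((μ.prod μ).prod (μ.prod μ))) := by
  set i0 : Fin m := ⟨0, by omega⟩
  set i1 : Fin m := ⟨1, by omega⟩
  have h01 : i0 ≠ i1 := by simp [i0, i1]
  set Ψ : (Fin m → 𝒳) → 𝒳 → 𝒳 → 𝒳 → 𝒳 → ℝ := fun x a a' b b' =>
    (partialDiff i0 a a' (partialDiff i1 b b' K) x) ^ 2 with hΨ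
  have hΨm : ∀ {α : Type _} [MeasurableSpace α] {u : α → Fin m → 𝒳} {a a' b b' : α → 𝒳},
      Measurable u → Measurable a → Measurable a' → Measurable b → Measurable b' →
      BddMeas fun s => Ψ (u s) (a s) (a' s) (b s) (b' s) := fun hu ha ha' hb hb' =>
    (hB.partialDiff_partialDiff i0 i1 hu ha ha' hb hb').pow 2
  have hΨ0 : ∀ x y a a' b b', Ψ (Function.update x i0 y) a a' b b' = Ψ x a a' b b' := by
    intro x y a a' b b'
    simp only [hΨ, partialDiff_update_self]
  have hΨ1 : ∀ x y a a' b b', Ψ (Function.update x i1 y) a a' b b' = Ψ x a a' b b' := by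
    intro x y a a' b b'
    simp only [hΨ, partialDiff, Function.update_comm h01.symm, Function.update_idem]
  rw [beta, dif_pos h]
  change ∫ p : (Fin m → 𝒳) × 𝒳 × 𝒳, Ψ p.1 (p.1 i0) p.2.1 (p.1 i1) p.2.2 ∂_ =
    ∫ r : (Fin m → 𝒳) × (𝒳 × 𝒳) × (𝒳 × 𝒳), Ψ r.1 r.2.1.1 r.2.1.2 r.2.2.1 r.2.2.2 ∂_
  have m1 : BddMeas fun p : (Fin m → 𝒳) × 𝒳 × 𝒳 => Ψ p.1 (p.1 i0) p.2.1 (p.1 i1) p.2.2 :=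
    hΨm (by fun_prop) (by fun_prop) (by fun_prop) (by fun_prop) (by fun_prop)
  have m2 : BddMeas fun r : (Fin m → 𝒳) × (𝒳 × 𝒳) × (𝒳 × 𝒳) =>
      Ψ r.1 r.2.1.1 r.2.1.2 r.2.2.1 r.2.2.2 :=
    hΨm (by fun_prop) (by fun_prop) (by fun_prop) (by fun_prop) (by fun_prop)
  have m3 : BddMeas fun x : Fin m → 𝒳 => ∫ w : 𝒳 × 𝒳, Ψ x (x i0) w.1 (x i1) w.2 ∂(μ.prod μ) :=
    m1.integral_right (μ.prod μ)
  have m4 : BddMeas fun q : ((Fin m → 𝒳) × 𝒳) × 𝒳 × 𝒳 => Ψ q.1.1 q.1.2 q.2.1 (q.1.1 i1) q.2.2 :=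
    hΨm (by fun_prop) (by fun_prop) (by fun_prop) (by fun_prop) (by fun_prop)
  have m5 : BddMeas fun x : Fin m → 𝒳 =>
      ∫ a, ∫ w : 𝒳 × 𝒳, Ψ x a w.1 (x i1) w.2 ∂(μ.prod μ) ∂μ :=
    (m4.integral_right (μ.prod μ)).integral_right μ
  rw [m1.integral_prod, m2.integral_prod, ← integral_update μ m3 i0]
  simp only [hΨ0, Function.update_self, Function.update_of_ne h01.symm]
  rw [← integral_update μ m5 i1]
  simp only [hΨ1, Function.update_self]
  congr 1
  funext x
  have c1 : BddMeas fun q : (𝒳 × 𝒳) × 𝒳 × 𝒳 => Ψ x q.1.2 q.2.1 q.1.1 q.2.2 :=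
    hΨm (by fun_prop) (by fun_prop) (by fun_prop) (by fun_prop) (by fun_prop)
  have c2 : BddMeas fun r : (𝒳 × 𝒳) × (𝒳 × 𝒳) => Ψ x r.1.1 r.1.2 r.2.1 r.2.2 :=
    hΨm (by fun_prop) (by fun_prop) (by fun_prop) (by fun_prop) (by fun_prop)
  have c3 : ∀ a b, BddMeas fun w : 𝒳 × 𝒳 => Ψ x a w.1 b w.2 := fun a b =>
    hΨm (by fun_prop) (by fun_prop) (by fun_prop) (by fun_prop) (by fun_prop)
  have c4 : ∀ a, BddMeas fun q : (𝒳 × 𝒳) × 𝒳 => Ψ x a q.1.2 q.1.1 q.2 := fun a =>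
    hΨm (by fun_prop) (by fun_prop) (by fun_prop) (by fun_prop) (by fun_prop)
  have c5 : ∀ q : 𝒳 × 𝒳, BddMeas fun p : 𝒳 × 𝒳 => Ψ x q.1 q.2 p.1 p.2 := fun q =>
    hΨm (by fun_prop) (by fun_prop) (by fun_prop) (by fun_prop) (by fun_prop)
  rw [c2.integral_prod, (c2.integral_right (μ.prod μ)).integral_prod,
    (c1.integral_right (μ.prod μ)).integral_comm μ μ]
  congr 1
  funext a
  simp only
  calc ∫ b, ∫ w : 𝒳 × 𝒳, Ψ x a w.1 b w.2 ∂(μ.prod μ) ∂μ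
      = ∫ b, ∫ a', ∫ b', Ψ x a a' b b' ∂μ ∂μ ∂μ := by
        congr 1; funext b; exact (c3 a b).integral_prod μ μ
    _ = ∫ a', ∫ b, ∫ b', Ψ x a a' b b' ∂μ ∂μ ∂μ := ((c4 a).integral_right μ).integral_comm μ μ
    _ = _ := by congr 1; funext a'; exact ((c5 (a, a')).integral_prod μ μ).symm

end BetaGamma

end UStat

namespace UStat

/-- A proportion `m / n` of the index sets contains `k`, and each such kernel changes by at most
`2`. -/
theorem abs_partialDiff_completeU_le {𝒳 : Type*} {m n : ℕ} {K : (Fin m → 𝒳) → ℝ}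
    (hK : ∀ x, |K x| ≤ 1) (hm : 1 ≤ m) (hmn : m < n)
    (k : Fin n) (y y' : 𝒳) (x : Fin n → 𝒳) : |partialDiff k y y' (completeU n K) x| ≤ 2 * m / n := by
  rw [partialDiff_completeU]
  set s := Finset.univ.filter fun W : {W : Finset (Fin n) // W.card = m} => k ∈ W.1 with hs
  have h1 : ∑ W, partialDiff k y y' (kernelOn K W) x =
      ∑ W ∈ s, partialDiff k y y' (kernelOn K W) x :=
    (Finset.sum_subset (Finset.subset_univ s) fun W _ hW =>
      partialDiff_kernelOn_of_notMem (by simpa [hs] using hW) y y' x).symm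
  simp only [h1, abs_mul]
  have h2 : |∑ W ∈ s, partialDiff k y y' (kernelOn K W) x| ≤ s.card * 2 := by
    refine (Finset.abs_sum_le_sum_abs _ _).trans ?_
    rw [← nsmul_eq_mul]
    refine Finset.sum_le_card_nsmul s _ 2 fun W _ => ?_
    simpa using abs_partialDiff_le (G := kernelOn K W) (fun x => hK _) k y y' x
  have h3 := card_filter_mem_div hm hmn k
  calc _ ≤ ((n.choose m : ℕ) : ℝ)⁻¹ * (s.card * 2) := by
        rw [abs_of_nonneg (by positivity)]
        gcongr
    _ = 2 * (s.card * ((n.choose m : ℕ) : ℝ)⁻¹) := by ring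
    _ = _ := by rw [h3]; ring

variable {𝒳 : Type*} [MeasurableSpace 𝒳] {m n : ℕ} {μ : Measure 𝒳} [IsProbabilityMeasure μ]
  {K : (Fin m → 𝒳) → ℝ}

/-! ### The first-order projection and `σ₁²`. -/

section Projection

/-- The first-order projection `y ↦ E[K(y, X₂, …, X_m)]`. -/
noncomputable def projection (μ : Measure 𝒳) (K : (Fin m → 𝒳) → ℝ) (i : Fin m) (y : 𝒳) : ℝ :=
  ∫ x, K (Function.update x i y) ∂(Measure.pi fun _ : Fin m => μ)

theorem BddMeas.projection (hB : BddMeas K) (i : Fin m) : BddMeas (projection μ K i) :=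
  (hB.update i).swap.integral_right (Measure.pi fun _ : Fin m => μ)

theorem integral_eval (i : Fin m) {h : 𝒳 → ℝ} (hh : BddMeas h) :
    ∫ x, h (x i) ∂(Measure.pi fun _ : Fin m => μ) = ∫ y, h y ∂μ := by
  have := measurePreserving_eval (fun _ : Fin m => μ) i
  conv_rhs =>
    rw [← this.map_eq, integral_map this.measurable.aemeasurable hh.meas.aestronglyMeasurable]

/-- By the defining property of conditional expectation it suffices to integrate over events
depending on coordinate `0`, where resampling that coordinate and Fubini apply (`key`). -/
theorem projection_ae_eq_condExp (hB : BddMeas K) (hm : 0 < m) :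
    (fun x => projection μ K ⟨0, hm⟩ (x ⟨0, hm⟩)) =ᵐ[Measure.pi fun _ : Fin m => μ]
      condExp (firstCoords 𝒳 m 1) (Measure.pi fun _ : Fin m => μ) K := by
  set i0 : Fin m := ⟨0, hm⟩
  set P := Measure.pi fun _ : Fin m => μ
  have hle : firstCoords 𝒳 m 1 ≤ MeasurableSpace.pi := by
    refine Measurable.comap_le ?_
    exact measurable_pi_iff.2 fun i => measurable_pi_apply _
  have hκ : BddMeas (projection μ K i0) := hB.projection i0
  have hκ0 : BddMeas fun x : Fin m → 𝒳 => projection μ K i0 (x i0) :=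
    hκ.comp (measurable_pi_apply i0)
  have hx0 : Measurable[firstCoords 𝒳 m 1] fun x : Fin m → 𝒳 => x i0 := by
    have h1 : Measurable[firstCoords 𝒳 m 1]
        (fun (x : Fin m → 𝒳) (i : {i : Fin m // (i : ℕ) < 1}) => x i) := comap_measurable _
    exact (measurable_pi_apply (⟨i0, Nat.zero_lt_one⟩ : {i : Fin m // (i : ℕ) < 1})).comp h1
  refine ae_eq_condExp_of_forall_setIntegral_eq hle (hB.integrable P)
    (fun s _ _ => (hκ0.integrable P).integrableOn) (fun s hs _ => ?_)
    (hκ.meas.comp hx0).stronglyMeasurable.aestronglyMeasurable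
  obtain ⟨t, ht, rfl⟩ := hs
  set s := (fun (x : Fin m → 𝒳) (i : {i : Fin m // (i : ℕ) < 1}) => x i) ⁻¹' t with hs
  have hsm : MeasurableSet s := hle s ⟨t, ht, rfl⟩
  -- Only `0` satisfies `i < 1`, so the event is determined by one point `y` of `𝒳`, seen as a
  -- constant family.
  set S : 𝒳 → ℝ := fun y => Set.indicator t (fun _ => (1 : ℝ)) fun _ => y
  have hSb : BddMeas S := by
    refine BddMeas.of_mem_Icc (a := 0) (b := 1)
      ((measurable_const.indicator ht).comp (measurable_pi_iff.2 fun i => measurable_id)) fun y => ?_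
    simp only [S, Set.indicator]
    split_ifs <;> simp
  have hind : ∀ x : Fin m → 𝒳, Set.indicator s (fun _ => (1 : ℝ)) x = S (x i0) := fun x => by
    have : (fun (i : {i : Fin m // (i : ℕ) < 1}) => x i) = fun _ => x i0 := by
      funext i
      congr 1
      exact Fin.ext (by have := i.2; simp [i0]; omega)
    simp only [S, ← this]
    rfl
  have key : ∀ F : (Fin m → 𝒳) → ℝ, BddMeas F →
      ∫ x in s, F x ∂P = ∫ y, S y * ∫ x, F (Function.update x i0 y) ∂P ∂μ := by
    intro F hF
    have hSF : BddMeas fun x : Fin m → 𝒳 => S (x i0) * F x :=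
      (hSb.comp (measurable_pi_apply i0)).mul hF
    calc ∫ x in s, F x ∂P = ∫ x, S (x i0) * F x ∂P := by
          rw [← integral_indicator hsm]
          congr 1
          funext x
          rw [← hind x]
          simp [Set.indicator]
      _ = ∫ x, ∫ y, S y * F (Function.update x i0 y) ∂μ ∂P := by
          rw [← integral_update μ hSF i0]
          simp only [Function.update_self]
          rfl
      _ = ∫ y, ∫ x, S y * F (Function.update x i0 y) ∂P ∂μ := by
          have := hSF.update i0
          simp only [Function.update_self] at this
          exact this.integral_comm P μ
      _ = _ := by simp only [integral_const_mul]
  rw [key _ hκ0, key K hB]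
  simp only [Function.update_self]
  congr 1
  funext y
  simp [projection, P]

theorem sigmaSq_one_eq (hB : BddMeas K) (hm : 0 < m) :
    sigmaSq μ K 1 = phiEnt (· ^ 2) μ (projection μ K ⟨0, hm⟩) := by
  have hκ : BddMeas (projection μ K ⟨0, hm⟩) := hB.projection _
  have hκ0 : BddMeas fun x : Fin m → 𝒳 => projection μ K ⟨0, hm⟩ (x ⟨0, hm⟩) :=
    hκ.comp (measurable_pi_apply _)
  rw [sigmaSq, ← variance_congr (projection_ae_eq_condExp hB hm),
    variance_eq_integral hκ0.meas.aemeasurable, integral_eval _ hκ, phiEnt_sq_eq hκ,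
    integral_eval (h := fun y => (projection μ K ⟨0, hm⟩ y - ∫ y, projection μ K ⟨0, hm⟩ y ∂μ) ^ 2)
      _ ((hκ.sub (.const _)).pow 2)]

end Projection

/-! ### Mean and mixed differences of the U-statistic. -/

section CompleteU

theorem BddMeas.kernelOn (hB : BddMeas K) (W : {W : Finset (Fin n) // W.card = m}) :
    BddMeas (kernelOn K W) :=
  hB.comp (measurable_pi_iff.2 fun _ => measurable_pi_apply _)

theorem BddMeas.completeU (hB : BddMeas K) : BddMeas (completeU n K) :=
  (BddMeas.sum _ fun W _ => hB.kernelOn W).const_mul _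

theorem integral_completeU (hB : BddMeas K) (hmn : m < n) :
    ∫ x, completeU n K x ∂(Measure.pi fun _ : Fin n => μ) = theta μ K := by
  have hW : ∀ W : {W : Finset (Fin n) // W.card = m},
      ∫ x, kernelOn K W x ∂(Measure.pi fun _ : Fin n => μ) = theta μ K := fun W =>
    integral_comp_injective μ (W.1.orderEmbOfFin W.2).injective hB
  have hc : ((n.choose m : ℕ) : ℝ) ≠ 0 := by exact_mod_cast (Nat.choose_pos hmn.le).ne'
  rw [completeU_eq, integral_const_mul,
    integral_finsetSum _ fun W _ => (hB.kernelOn W).integrable _]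
  simp only [hW, Finset.sum_const, Finset.card_univ, Fintype.card_finset_len, Fintype.card_fin,
    nsmul_eq_mul]
  field_simp

theorem sum_filter_mul_const {ι : Type*} [Fintype ι] (p : ι → Prop) [DecidablePred p]
    {a : ι → ℝ} {b c : ℝ} (h : ∀ i, p i → a i = b) (h0 : ∀ i, ¬p i → a i = 0) :
    c * ∑ i, a i = ((Finset.univ.filter p).card * c) * b := by
  have : ∑ i, a i = ∑ i ∈ Finset.univ.filter p, b := by
    rw [Finset.sum_filter]
    refine Finset.sum_congr rfl fun i _ => ?_
    split_ifs with hi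
    · exact h i hi
    · exact h0 i hi
  rw [this]
  simp
  ring

theorem integral_partialDiff_completeU (hB : BddMeas K)
    (hKs : ∀ (π : Equiv.Perm (Fin m)) (x : Fin m → 𝒳), K (fun j => x (π j)) = K x)
    (hm : 1 ≤ m) (hmn : m < n) (k : Fin n) (y y' : 𝒳) :
    ∫ x, partialDiff k y y' (completeU n K) x ∂(Measure.pi fun _ : Fin n => μ) =
      m / n * (projection μ K ⟨0, hm⟩ y - projection μ K ⟨0, hm⟩ y') := by
  have hd : ∀ W : {W : Finset (Fin n) // W.card = m},
      BddMeas fun x => partialDiff k y y' (kernelOn K W) x := fun W =>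
    (hB.kernelOn W).partialDiff k measurable_id measurable_const measurable_const
  rw [partialDiff_completeU, integral_const_mul,
    integral_finsetSum _ fun W _ => (hd W).integrable _,
    sum_filter_mul_const (fun W : {W : Finset (Fin n) // W.card = m} => k ∈ W.1)
      (b := projection μ K ⟨0, hm⟩ y - projection μ K ⟨0, hm⟩ y'), card_filter_mem_div hm hmn k]
  · intro W hW
    obtain ⟨e, he, rfl, heK⟩ := exists_kernelOn_eq hKs hm W hW
    rw [heK, partialDiff_comp_injective he]
    refine (integral_comp_injective μ he (F := partialDiff ⟨0, hm⟩ y y' K)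
      (hB.partialDiff ⟨0, hm⟩ measurable_id measurable_const measurable_const)).trans ?_
    exact integral_sub ((hB.update_left _ y).integrable _) ((hB.update_left _ y').integrable _)
  · intro W hW
    simp [partialDiff_kernelOn_of_notMem hW]

theorem integral_partialDiff_sq_completeU_le_gamma (hKm : Measurable K) (hK : ∀ x, |K x| ≤ 1)
    (hKs : ∀ (π : Equiv.Perm (Fin m)) (x : Fin m → 𝒳), K (fun j => x (π j)) = K x)
    (hm : 1 ≤ m) (hmn : m < n) {k l : Fin n} (hkl : k ≠ l) (x : Fin n → 𝒳) (z z' : 𝒳) :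
    ∫ p : 𝒳 × 𝒳, (partialDiff k z z' (partialDiff l p.1 p.2 (completeU n K)) x) ^ 2 ∂(μ.prod μ) ≤
      (m * (m - 1) / (n * (n - 1)) : ℝ) ^ 2 * gamma μ K := by
  have hB : BddMeas K := ⟨hKm, 1, hK⟩
  simp only [partialDiff_partialDiff_completeU]
  rw [← card_filter_mem_mem_div hm hmn hkl]
  refine integral_sq_avg_le _ _ (fun W => (hB.kernelOn W).partialDiff_partialDiff k l
    measurable_const measurable_const measurable_const measurable_fst measurable_snd)
    (fun W hW => ?_) (fun W hW p => partialDiff_partialDiff_kernelOn_of_not hkl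
      (by simpa using hW) _ _ _ _ _) _
  simp only [Finset.mem_filter, Finset.mem_univ, true_and] at hW
  -- An index set containing two distinct indices forces `2 ≤ m`, so the value `0` of `gamma` for `m
  -- = 1` is never met here.
  have h2 : 2 ≤ m := by
    rw [← W.2, ← Finset.card_pair hkl]
    exact Finset.card_le_card (by simp [Finset.insert_subset_iff, hW])
  obtain ⟨e, he, rfl, rfl, heK⟩ := exists_kernelOn_eq_pair hKs h2 W hW.1 hW.2 hkl
  simp only [heK, partialDiff_comp_injective he]
  exact integral_partialDiff_sq_le_gamma hKm hK h2 (x ∘ e) z z'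

theorem integral_partialDiff_sq_completeU_le_beta (hB : BddMeas K)
    (hKs : ∀ (π : Equiv.Perm (Fin m)) (x : Fin m → 𝒳), K (fun j => x (π j)) = K x)
    (hm : 1 ≤ m) (hmn : m < n) {k l : Fin n} (hkl : k ≠ l) :
    ∫ r : (Fin n → 𝒳) × (𝒳 × 𝒳) × (𝒳 × 𝒳), (partialDiff k r.2.1.1 r.2.1.2
      (partialDiff l r.2.2.1 r.2.2.2 (completeU n K)) r.1) ^ 2
      ∂((Measure.pi fun _ : Fin n => μ).prod ((μ.prod μ).prod (μ.prod μ))) ≤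
      (m * (m - 1) / (n * (n - 1)) : ℝ) ^ 2 * beta μ K := by
  simp only [partialDiff_partialDiff_completeU]
  rw [← card_filter_mem_mem_div hm hmn hkl]
  refine integral_sq_avg_le _ _ (fun W => (hB.kernelOn W).partialDiff_partialDiff k l
    (by fun_prop) (by fun_prop) (by fun_prop) (by fun_prop) (by fun_prop))
    (fun W hW => ?_) (fun W hW p => partialDiff_partialDiff_kernelOn_of_not hkl
      (by simpa using hW) _ _ _ _ _) _
  simp only [Finset.mem_filter, Finset.mem_univ, true_and] at hW
  have h2 : 2 ≤ m := by
    rw [← W.2, ← Finset.card_pair hkl]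
    exact Finset.card_le_card (by simp [Finset.insert_subset_iff, hW])
  obtain ⟨e, he, rfl, rfl, heK⟩ := exists_kernelOn_eq_pair hKs h2 W hW.1 hW.2 hkl
  simp only [heK, partialDiff_comp_injective he]
  have hD : BddMeas fun r : (Fin m → 𝒳) × (𝒳 × 𝒳) × (𝒳 × 𝒳) =>
      (partialDiff ⟨0, by omega⟩ r.2.1.1 r.2.1.2
        (partialDiff ⟨1, by omega⟩ r.2.2.1 r.2.2.2 K) r.1) ^ 2 :=
    (hB.partialDiff_partialDiff _ _ (by fun_prop) (by fun_prop) (by fun_prop) (by fun_prop)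
      (by fun_prop)).pow 2
  have hmap := measurePreserving_comp_injective μ he
  have hmap2 := hmap.prod (MeasurePreserving.id ((μ.prod μ).prod (μ.prod μ)))
  rw [beta_eq hB h2, ← hmap2.map_eq,
    integral_map hmap2.measurable.aemeasurable hD.meas.aestronglyMeasurable]
  rfl

end CompleteU

end UStat

namespace UStat

/-! ### Self-bounding property and mean of the sum of conditional variances. -/

section CauchySchwarz

theorem sq_sum_integral_mul_le {Ω ι : Type*} [MeasurableSpace Ω] (Q : Measure Ω)
    [IsFiniteMeasure Q] (s : Finset ι) {a b : ι → Ω → ℝ} (ha : ∀ i, BddMeas (a i))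
    (hb : ∀ i, BddMeas (b i)) :
    (∑ i ∈ s, ∫ ω, a i ω * b i ω ∂Q) ^ 2 ≤
      (∑ i ∈ s, ∫ ω, a i ω ^ 2 ∂Q) * ∑ i ∈ s, ∫ ω, b i ω ^ 2 ∂Q := by
  have h : ∀ t : ℝ, 0 ≤ (∑ i ∈ s, ∫ ω, a i ω ^ 2 ∂Q) * (t * t) +
      (2 * ∑ i ∈ s, ∫ ω, a i ω * b i ω ∂Q) * t + ∑ i ∈ s, ∫ ω, b i ω ^ 2 ∂Q := by
    intro t
    have h1 : ∀ i ∈ s, ∫ ω, (t * a i ω + b i ω) ^ 2 ∂Q = (∫ ω, a i ω ^ 2 ∂Q) * (t * t) +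
        (∫ ω, a i ω * b i ω ∂Q) * (2 * t) + ∫ ω, b i ω ^ 2 ∂Q := fun i _ => by
      have : ∀ ω, (t * a i ω + b i ω) ^ 2 =
          a i ω ^ 2 * (t * t) + a i ω * b i ω * (2 * t) + b i ω ^ 2 := fun ω => by ring
      simp only [this]
      have i1 := ((ha i).pow 2).mul (.const (t * t))
      have i2 := ((ha i).mul (hb i)).mul (.const (2 * t))
      rw [integral_add ((i1.add i2).integrable Q) (((hb i).pow 2).integrable Q),
        integral_add (i1.integrable Q) (i2.integrable Q), integral_mul_const, integral_mul_const]
    have h2 : 0 ≤ ∑ i ∈ s, ∫ ω, (t * a i ω + b i ω) ^ 2 ∂Q :=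
      Finset.sum_nonneg fun i _ => integral_nonneg fun ω => sq_nonneg _
    rw [Finset.sum_congr rfl h1, Finset.sum_add_distrib, Finset.sum_add_distrib,
      ← Finset.sum_mul, ← Finset.sum_mul] at h2
    linarith
  have := discrim_le_zero h
  rw [discrim] at this
  linarith

end CauchySchwarz

variable {𝒳 : Type*} [MeasurableSpace 𝒳] {m n : ℕ} {μ : Measure 𝒳} [IsProbabilityMeasure μ]
  {K : (Fin m → 𝒳) → ℝ}

/-- The sum of conditional variances is self-bounding when the mixed differences are bounded. -/
theorem sumVar_sub_sq_le {f : (Fin n → 𝒳) → ℝ} (hf : BddMeas f) {c : ℝ}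
    (hc : ∀ (k l : Fin n), k ≠ l → ∀ (x : Fin n → 𝒳) (z z' : 𝒳),
      ∫ p : 𝒳 × 𝒳, (partialDiff k z z' (partialDiff l p.1 p.2 f) x) ^ 2 ∂(μ.prod μ) ≤ c)
    (x : Fin n → 𝒳) (k : Fin n) (y : 𝒳) :
    (sumVar μ f x - sumVar μ f (Function.update x k y)) ^ 2 ≤
      2 * (((n : ℝ) - 1) * c / 2) * (sumVar μ f x + sumVar μ f (Function.update x k y)) := by
  set x' := Function.update x k y
  set Q := μ.prod μ
  set u : Fin n → 𝒳 × 𝒳 → ℝ := fun l p => partialDiff l p.1 p.2 f x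
  set w : Fin n → 𝒳 × 𝒳 → ℝ := fun l p => partialDiff l p.1 p.2 f x'
  have hu : ∀ l, BddMeas (u l) := fun l =>
    hf.partialDiff l measurable_const measurable_fst measurable_snd
  have hw : ∀ l, BddMeas (w l) := fun l =>
    hf.partialDiff l measurable_const measurable_fst measurable_snd
  -- Each difference of squares is factored; Cauchy-Schwarz then separates the mixed differences
  -- (`hdiff`) from a factor comparable to `V x + V x'` (`hadd`).
  have hsub : sumVar μ f x - sumVar μ f x' =
      1 / 2 * ∑ l, ∫ p, (u l p - w l p) * (u l p + w l p) ∂Q := by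
    rw [sumVar_eq hf, sumVar_eq hf, ← Finset.sum_sub_distrib, Finset.mul_sum]
    refine Finset.sum_congr rfl fun l _ => ?_
    rw [← mul_sub, ← integral_sub (((hu l).pow 2).integrable Q) (((hw l).pow 2).integrable Q)]
    congr 2
    funext p
    ring
  have hadd : ∑ l, ∫ p, (u l p + w l p) ^ 2 ∂Q ≤ 4 * (sumVar μ f x + sumVar μ f x') := by
    rw [sumVar_eq hf, sumVar_eq hf, ← Finset.sum_add_distrib, Finset.mul_sum]
    refine Finset.sum_le_sum fun l _ => ?_
    have := integral_mono ((((hu l).add (hw l)).pow 2).integrable Q)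
      (((((hu l).pow 2).add ((hw l).pow 2)).const_mul 2).integrable Q) fun p => by
        nlinarith [sq_nonneg (u l p - w l p)]
    rw [integral_const_mul, integral_add (((hu l).pow 2).integrable Q)
      (((hw l).pow 2).integrable Q)] at this
    refine this.trans (le_of_eq ?_)
    ring
  have hdiff : ∑ l, ∫ p, (u l p - w l p) ^ 2 ∂Q ≤ ((n : ℝ) - 1) * c := by
    rw [← Finset.add_sum_erase _ _ (Finset.mem_univ k)]
    -- The `k`-th difference does not see the change of coordinate `k`; hence the factor `n - 1` and
    -- not `n`.
    have h0 : ∫ p, (u k p - w k p) ^ 2 ∂Q = 0 := by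
      simp [u, w, x', partialDiff_update_self]
    have h1 : ∑ l ∈ Finset.univ.erase k, ∫ p, (u l p - w l p) ^ 2 ∂Q ≤
        (Finset.univ.erase k).card • c := by
      refine Finset.sum_le_card_nsmul _ _ _ fun l hl => ?_
      have := hc k l (Finset.ne_of_mem_erase hl).symm x (x k) y
      refine le_trans (le_of_eq ?_) this
      congr 1
      funext p
      rw [partialDiff, Function.update_eq_self]
    rw [Finset.card_erase_of_mem (Finset.mem_univ k), Finset.card_univ, Fintype.card_fin,
      nsmul_eq_mul, Nat.cast_sub k.pos, Nat.cast_one] at h1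
    linarith
  have hCS := sq_sum_integral_mul_le Q Finset.univ (fun l => (hu l).sub (hw l))
    fun l => (hu l).add (hw l)
  have hV : 0 ≤ 4 * (sumVar μ f x + sumVar μ f x') := by
    have := sumVar_nonneg (μ := μ) hf x
    have := sumVar_nonneg (μ := μ) hf x'
    positivity
  have h1 := hCS.trans (mul_le_mul hdiff hadd (Finset.sum_nonneg fun l _ =>
    integral_nonneg fun p => sq_nonneg _) ((Finset.sum_nonneg fun l _ =>
    integral_nonneg fun p => sq_nonneg _).trans hdiff))
  rw [hsub, mul_pow]
  linarith

theorem integral_sq_le_sq_integral_add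
    {f : (Fin n → 𝒳) → ℝ} (h : BddMeas f) :
    ∫ x, f x ^ 2 ∂(Measure.pi fun _ : Fin n => μ) ≤
      (∫ x, f x ∂(Measure.pi fun _ : Fin n => μ)) ^ 2 +
        ∫ x, sumVar μ f x ∂(Measure.pi fun _ : Fin n => μ) := by
  have := phiEnt_sq_le_integral_sumVar (μ := μ) h
  simp only [phiEnt] at this
  linarith

/-- The expected sum of conditional variances is bounded by the variances of the first-order
projections and the mean squared mixed differences. -/
theorem integral_sumVar_le {f : (Fin n → 𝒳) → ℝ} (hf : BddMeas f) {c s : ℝ}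
    (hs : ∀ l : Fin n, 1 / 2 * ∫ p : 𝒳 × 𝒳,
      (∫ x, partialDiff l p.1 p.2 f x ∂(Measure.pi fun _ : Fin n => μ)) ^ 2 ∂(μ.prod μ) ≤ s)
    (hc : ∀ k l : Fin n, k ≠ l → ∫ r : (Fin n → 𝒳) × (𝒳 × 𝒳) × (𝒳 × 𝒳),
      (partialDiff k r.2.1.1 r.2.1.2 (partialDiff l r.2.2.1 r.2.2.2 f) r.1) ^ 2
      ∂((Measure.pi fun _ : Fin n => μ).prod ((μ.prod μ).prod (μ.prod μ))) ≤ c) :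
    ∫ x, sumVar μ f x ∂(Measure.pi fun _ : Fin n => μ) ≤ n * s + n * (n - 1) * c / 4 := by
  set P := Measure.pi fun _ : Fin n => μ
  set Q := μ.prod μ
  have hu : ∀ l : Fin n, BddMeas fun r : (Fin n → 𝒳) × (𝒳 × 𝒳) =>
      partialDiff l r.2.1 r.2.2 f r.1 := fun l =>
    hf.partialDiff l measurable_fst (by fun_prop) (by fun_prop)
  have hup : ∀ (l : Fin n) (p : 𝒳 × 𝒳), BddMeas (partialDiff l p.1 p.2 f) := fun l p =>
    (hu l).section_left p
  have hD : ∀ k l : Fin n, BddMeas fun r : (Fin n → 𝒳) × (𝒳 × 𝒳) × (𝒳 × 𝒳) =>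
      (partialDiff k r.2.1.1 r.2.1.2 (partialDiff l r.2.2.1 r.2.2.2 f) r.1) ^ 2 := fun k l =>
    (hf.partialDiff_partialDiff k l (by fun_prop) (by fun_prop) (by fun_prop) (by fun_prop)
      (by fun_prop)).pow 2
  have hDq : ∀ k l : Fin n, BddMeas fun r : (𝒳 × 𝒳) × (Fin n → 𝒳) => ∫ q : 𝒳 × 𝒳,
      (partialDiff k q.1 q.2 (partialDiff l r.1.1 r.1.2 f) r.2) ^ 2 ∂Q := fun k l =>
    ((hD k l).comp (u := fun t : ((𝒳 × 𝒳) × (Fin n → 𝒳)) × (𝒳 × 𝒳) => (t.1.2, t.2, t.1.1))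
      (by fun_prop)).integral_right Q
  -- The second moment of the `l`-th difference is its squared mean, which contributes `s`, plus its
  -- variance. Efron-Stein bounds the variance by `n - 1` mixed terms, each at most `c / 2`, as the
  -- term `k = l` vanishes; the outer `1 / 2` gives `(n - 1) c / 4`.
  have hone : ∀ l : Fin n, 1 / 2 * ∫ x, ∫ p, (partialDiff l p.1 p.2 f x) ^ 2 ∂Q ∂P ≤
      s + ((n : ℝ) - 1) * c / 4 := by
    intro l
    have hsum : ∫ p, ∫ x, sumVar μ (partialDiff l p.1 p.2 f) x ∂P ∂Q ≤
        ((n : ℝ) - 1) * (c / 2) := by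
      have e1 : ∀ p : 𝒳 × 𝒳, ∫ x, sumVar μ (partialDiff l p.1 p.2 f) x ∂P =
          ∑ k, 1 / 2 * ∫ x, ∫ q, (partialDiff k q.1 q.2 (partialDiff l p.1 p.2 f) x) ^ 2 ∂Q ∂P := by
        intro p
        simp only [sumVar_eq (hup l p)]
        rw [integral_finsetSum _ fun k _ =>
          (((hDq k l).section_right p).const_mul (1 / 2)).integrable P]
        simp only [integral_const_mul]
      simp only [e1]
      rw [integral_finsetSum _ fun k _ =>
        (((hDq k l).integral_right P).const_mul (1 / 2)).integrable Q]
      have e2 : ∀ k, ∫ p : 𝒳 × 𝒳, 1 / 2 * ∫ x, ∫ q : 𝒳 × 𝒳,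
          (partialDiff k q.1 q.2 (partialDiff l p.1 p.2 f) x) ^ 2 ∂Q ∂P ∂Q =
          1 / 2 * ∫ r, (partialDiff k r.2.1.1 r.2.1.2 (partialDiff l r.2.2.1 r.2.2.2 f) r.1) ^ 2
            ∂(P.prod (Q.prod Q)) := by
        intro k
        rw [integral_const_mul, (hDq k l).integral_comm Q P, (hD k l).integral_prod]
        congr 2
        funext x
        have := (hD k l).section_right x
        rw [this.integral_prod, this.integral_comm]
      simp only [e2]
      rw [← Finset.add_sum_erase _ _ (Finset.mem_univ l)]
      have h0 : 1 / 2 * ∫ r : (Fin n → 𝒳) × (𝒳 × 𝒳) × (𝒳 × 𝒳),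
          (partialDiff l r.2.1.1 r.2.1.2 (partialDiff l r.2.2.1 r.2.2.2 f) r.1) ^ 2
            ∂(P.prod (Q.prod Q)) = 0 := by
        simp [partialDiff_self]
      have h1 := Finset.sum_le_card_nsmul (Finset.univ.erase l) (fun k => 1 / 2 *
        ∫ r, (partialDiff k r.2.1.1 r.2.1.2 (partialDiff l r.2.2.1 r.2.2.2 f) r.1) ^ 2
            ∂(P.prod (Q.prod Q))) (c / 2) fun k hk => by
        have := hc k l (Finset.ne_of_mem_erase hk)
        linarith
      rw [Finset.card_erase_of_mem (Finset.mem_univ l), Finset.card_univ, Fintype.card_fin,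
        nsmul_eq_mul, Nat.cast_sub l.pos, Nat.cast_one] at h1
      rw [h0, zero_add]
      exact h1
    have hSb : BddMeas fun p : 𝒳 × 𝒳 => ∫ x, sumVar μ (partialDiff l p.1 p.2 f) x ∂P := by
      have : BddMeas fun r : (𝒳 × 𝒳) × (Fin n → 𝒳) =>
          sumVar μ (partialDiff l r.1.1 r.1.2 f) r.2 := by
        simp only [sumVar_eq (hup l _)]
        exact BddMeas.sum _ fun k _ => (hDq k l).const_mul _
      exact this.integral_right P
    have hIb : BddMeas fun p : 𝒳 × 𝒳 => (∫ x, partialDiff l p.1 p.2 f x ∂P) ^ 2 :=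
      ((hu l).swap.integral_right P).pow 2
    have hle := integral_mono ((((hu l).pow 2).swap.integral_right P).integrable Q)
      ((hIb.add hSb).integrable Q) fun p => integral_sq_le_sq_integral_add (hup l p)
    rw [integral_add (hIb.integrable Q) (hSb.integrable Q)] at hle
    rw [((hu l).pow 2).integral_comm P Q]
    have := hs l
    linarith
  have hsplit : ∫ x, sumVar μ f x ∂P =
      ∑ l, 1 / 2 * ∫ x, ∫ p, (partialDiff l p.1 p.2 f x) ^ 2 ∂Q ∂P := by
    simp only [sumVar_eq hf]
    rw [integral_finsetSum _ fun l _ =>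
      ((((hu l).pow 2).integral_right Q).const_mul (1 / 2)).integrable P]
    simp only [integral_const_mul]
  rw [hsplit]
  refine (Finset.sum_le_card_nsmul _ _ _ fun l _ => hone l).trans (le_of_eq ?_)
  simp
  ring

end UStat

namespace UStat

/-! ### Constants for the U-statistic and inversion of the tail bound. -/

theorem sigmaSq_nonneg {𝒳 : Type*} [MeasurableSpace 𝒳] {m : ℕ} {μ : Measure 𝒳}
    {K : (Fin m → 𝒳) → ℝ} (k : ℕ) : 0 ≤ sigmaSq μ K k := variance_nonneg _ _

/-- The number of ordered pairs times the squared proportion of index sets through a pair; it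
multiplies both `β` and `γ`. The inequality comes down to `(m - 1) n ≤ m (n - 1)`. -/
theorem sq_div_mul_sub_one_le {m n : ℝ} (hm : 1 ≤ m) (hmn : m < n) :
    n * (n - 1) * (m * (m - 1) / (n * (n - 1))) ^ 2 ≤ m ^ 4 / n ^ 2 := by
  have hn : 0 < n := by linarith
  have hn1 : 0 < n - 1 := by linarith
  have h1 : n * (n - 1) * (m * (m - 1) / (n * (n - 1))) ^ 2 =
      m ^ 2 * (m - 1) ^ 2 / (n * (n - 1)) := by
    field_simp
  rw [h1, div_le_div_iff₀ (by positivity) (by positivity)]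
  have h2 : (m - 1) * n ≤ m * (n - 1) := by linarith
  have h3 : (m - 1) ^ 2 * n ≤ m ^ 2 * (n - 1) := by
    calc (m - 1) ^ 2 * n = (m - 1) * ((m - 1) * n) := by ring
      _ ≤ (m - 1) * (m * (n - 1)) := mul_le_mul_of_nonneg_left h2 (by linarith)
      _ ≤ m * (m * (n - 1)) := by
          refine mul_le_mul_of_nonneg_right (by linarith) ?_
          positivity
      _ = _ := by ring
  calc m ^ 2 * (m - 1) ^ 2 * n ^ 2 = m ^ 2 * n * ((m - 1) ^ 2 * n) := by ring
    _ ≤ m ^ 2 * n * (m ^ 2 * (n - 1)) := by gcongr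
    _ = _ := by ring

variable {𝒳 : Type*} [MeasurableSpace 𝒳] {m n : ℕ} {μ : Measure 𝒳} [IsProbabilityMeasure μ]
  {K : (Fin m → 𝒳) → ℝ}

/-- Bernstein-type tail bound for the complete U-statistic under the product measure. -/
theorem completeU_tail_le (hKm : Measurable K) (hK : ∀ x, |K x| ≤ 1)
    (hKs : ∀ (π : Equiv.Perm (Fin m)) (x : Fin m → 𝒳), K (fun j => x (π j)) = K x)
    (hm : 1 ≤ m) (hmn : m < n) {t : ℝ} (ht : 0 < t) :
    (Measure.pi fun _ : Fin n => μ).real {x | completeU n K x - theta μ K > t} ≤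
      Real.exp (-((n : ℝ) * t ^ 2) /
        (2 * (m : ℝ) ^ 2 * sigmaSq μ K 1 + (m : ℝ) ^ 4 * beta μ K / (2 * (n : ℝ)) +
          ((m : ℝ) ^ 2 * √(gamma μ K) + 4 / 3 * (m : ℝ)) * t)) := by
  have hB : BddMeas K := ⟨hKm, 1, hK⟩
  have hf : BddMeas (completeU n K) := hB.completeU
  have hm1 : (1 : ℝ) ≤ m := by exact_mod_cast hm
  have hmn' : (m : ℝ) < n := by exact_mod_cast hmn
  have hn : (0 : ℝ) < n := by linarith
  have hγ : 0 ≤ gamma μ K := gamma_nonneg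
  have hβ : 0 ≤ beta μ K := beta_nonneg
  set p : ℝ := m * (m - 1) / (n * (n - 1)) with hp
  have hp2 := sq_div_mul_sub_one_le hm1 hmn'
  rw [← hp] at hp2
  have hb : ∀ x k y, completeU n K x - completeU n K (Function.update x k y) ≤ 2 * m / n := by
    intro x k y
    have h1 := abs_partialDiff_completeU_le hK hm hmn k (x k) y x
    rw [partialDiff, Function.update_eq_self] at h1
    exact (le_abs_self _).trans h1
  have hV := sumVar_sub_sq_le (μ := μ) hf fun k l hkl x z z' =>
    integral_partialDiff_sq_completeU_le_gamma (μ := μ) hKm hK hKs hm hmn hkl x z z'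
  have hσ : ∀ l : Fin n, 1 / 2 * ∫ q : 𝒳 × 𝒳, (∫ x, partialDiff l q.1 q.2 (completeU n K) x
      ∂(Measure.pi fun _ : Fin n => μ)) ^ 2 ∂(μ.prod μ) ≤ (m / n : ℝ) ^ 2 * sigmaSq μ K 1 := by
    intro l
    simp only [integral_partialDiff_completeU hB hKs hm hmn, mul_pow]
    rw [integral_const_mul, sigmaSq_one_eq hB hm, phiEnt_sq_eq_half (hB.projection _)]
    exact le_of_eq (by ring)
  have hE := integral_sumVar_le (μ := μ) hf hσ fun k l hkl =>
    integral_partialDiff_sq_completeU_le_beta (μ := μ) hB hKs hm hmn hkl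
  have hv : ∫ x, sumVar μ (completeU n K) x ∂(Measure.pi fun _ : Fin n => μ) ≤
      (m : ℝ) ^ 2 * sigmaSq μ K 1 / n + (m : ℝ) ^ 4 * beta μ K / (4 * (n : ℝ) ^ 2) := by
    refine hE.trans (add_le_add (le_of_eq (by field_simp)) ?_)
    calc (n : ℝ) * (n - 1) * (p ^ 2 * beta μ K) / 4 = n * (n - 1) * p ^ 2 * (beta μ K / 4) := by
          ring
      _ ≤ (m : ℝ) ^ 4 / (n : ℝ) ^ 2 * (beta μ K / 4) :=
          mul_le_mul_of_nonneg_right hp2 (by positivity)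
      _ = _ := by field_simp
  have hr : (0 : ℝ) ≤ ((n : ℝ) - 1) * (p ^ 2 * gamma μ K) / 2 := by
    have : (0 : ℝ) ≤ n - 1 := by linarith
    positivity
  have hR : (n : ℝ) * (((n : ℝ) - 1) * (p ^ 2 * gamma μ K) / 2) ≤
      (m : ℝ) ^ 4 * gamma μ K / (2 * (n : ℝ) ^ 2) := by
    calc _ = n * (n - 1) * p ^ 2 * (gamma μ K / 2) := by ring
      _ ≤ (m : ℝ) ^ 4 / (n : ℝ) ^ 2 * (gamma μ K / 2) :=
          mul_le_mul_of_nonneg_right hp2 (by positivity)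
      _ = _ := by field_simp
  have key := measureReal_gt_le_bernstein hf (b := 2 * m / n) (by positivity) hb hr hR hV hv ht
  rw [integral_completeU hB hmn] at key
  -- Thus `c = 2 m / (3 n) + m² √γ / (2 n)`, and `2 n c` is the coefficient of `t` in the claim.
  have hsqrt : √((m : ℝ) ^ 4 * gamma μ K / (2 * (n : ℝ) ^ 2) / 2) =
      (m : ℝ) ^ 2 * √(gamma μ K) / (2 * n) := by
    have : (m : ℝ) ^ 4 * gamma μ K / (2 * (n : ℝ) ^ 2) / 2 =
        ((m : ℝ) ^ 2 * √(gamma μ K) / (2 * n)) ^ 2 := by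
      rw [div_pow, mul_pow, Real.sq_sqrt hγ]
      field_simp
    rw [this, Real.sqrt_sq (by positivity)]
  rw [hsqrt] at key
  refine key.trans (le_of_eq ?_)
  congr 1
  have hσ0 := sigmaSq_nonneg (μ := μ) (K := K) 1
  have hD : 2 * ((m : ℝ) ^ 2 * sigmaSq μ K 1 / n + (m : ℝ) ^ 4 * beta μ K / (4 * (n : ℝ) ^ 2) +
      (2 * m / n / 3 + (m : ℝ) ^ 2 * √(gamma μ K) / (2 * n)) * t) =
      (2 * (m : ℝ) ^ 2 * sigmaSq μ K 1 + (m : ℝ) ^ 4 * beta μ K / (2 * (n : ℝ)) +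
          ((m : ℝ) ^ 2 * √(gamma μ K) + 4 / 3 * (m : ℝ)) * t) / n := by
    field_simp
    ring
  rw [hD, div_div_eq_mul_div]
  ring

theorem sqrt_add_le_sqrt_add_sqrt {x y : ℝ} (hx : 0 ≤ x) (hy : 0 ≤ y) :
    √(x + y) ≤ √x + √y := by
  refine Real.sqrt_le_iff.2 ⟨by positivity, ?_⟩
  rw [add_sq, Real.sq_sqrt hx, Real.sq_sqrt hy]
  have : 0 ≤ 2 * √x * √y := by positivity
  linarith

/-- Inversion of a Bernstein-type tail bound. -/
theorem bernstein_inversion {A B L n t : ℝ} (hA : 0 ≤ A) (hB : 0 < B) (hL : 0 < L) (hn : 0 < n)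
    (ht : √(A * L / n) + B * L / n ≤ t) : -(n * t ^ 2) / (A + B * t) ≤ -L := by
  have hs := Real.sqrt_nonneg (A * L / n)
  have hbl : 0 < B * L / n := by positivity
  have ht0 : 0 < t := by linarith
  have hsq := Real.sq_sqrt (show 0 ≤ A * L / n by positivity)
  rw [div_le_iff₀ (by positivity)]
  set w := √(A * L / n)
  -- From `w ≤ t - B L / n` and `w ≤ t` follows `w² ≤ t (t - B L / n)`, with `w² = A L / n`.
  have h1 : A * L / n + B * L / n * t ≤ t ^ 2 := by
    have h2 : w ≤ t - B * L / n := by linarith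
    have h3 : w * w ≤ (t - B * L / n) * t := by
      refine mul_le_mul h2 (by linarith) hs (by linarith)
    rw [← hsq]
    linarith
  have h2 := mul_le_mul_of_nonneg_left h1 hn.le
  have h3 : n * (A * L / n + B * L / n * t) = L * (A + B * t) := by field_simp
  linarith

end UStat

/-! ### Transfer to the random sample. -/

theorem mainTheorem2 {𝒳 Ω : Type*} [MeasurableSpace 𝒳] [MeasurableSpace Ω]
    (m n : ℕ) (hm : 1 ≤ m) (hmn : m < n)
    (μ : Measure 𝒳) [IsProbabilityMeasure μ]
    (K : (Fin m → 𝒳) → ℝ) (hKmeas : Measurable K)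
    (hKrange : ∀ x, K x ∈ Set.Icc (-1 : ℝ) 1)
    (hKsymm : ∀ (π : Equiv.Perm (Fin m)) (x : Fin m → 𝒳), K (fun j => x (π j)) = K x)
    (P : Measure Ω) [IsProbabilityMeasure P]
    (X : Fin n → Ω → 𝒳) (hXmeas : ∀ i, Measurable (X i))
    (hXindep : iIndepFun X P) (hXlaw : ∀ i, P.map (X i) = μ) :
    (∀ t : ℝ, 0 < t →
      P.real {ω | UStat.completeU n K (fun i => X i ω) - UStat.theta μ K > t} ≤
        Real.exp (-((n : ℝ) * t ^ 2) /
          (2 * (m : ℝ) ^ 2 * UStat.sigmaSq μ K 1 + (m : ℝ) ^ 4 * UStat.beta μ K / (2 * (n : ℝ)) +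
            ((m : ℝ) ^ 2 * √(UStat.gamma μ K) + 4 / 3 * (m : ℝ)) * t))) ∧
    (∀ δ : ℝ, 0 < δ → δ ≤ 1 / Real.exp 1 →
      P.real {ω | UStat.completeU n K (fun i => X i ω) - UStat.theta μ K ≤
          √(2 * (m : ℝ) ^ 2 * UStat.sigmaSq μ K 1 * Real.log (1 / δ) / (n : ℝ)) +
            (UStat.alpha μ K * (m : ℝ) ^ 2 + 4 * (m : ℝ) / 3) * Real.log (1 / δ) / (n : ℝ)} ≥
        1 - δ) := by
  have hK : ∀ x, |K x| ≤ 1 := fun x => abs_le.2 (hKrange x)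
  have hf : UStat.BddMeas (UStat.completeU n K) := UStat.BddMeas.completeU ⟨hKmeas, 1, hK⟩
  have hXm : Measurable fun ω i => X i ω := measurable_pi_iff.2 hXmeas
  have hlaw : P.map (fun ω i => X i ω) = Measure.pi fun _ : Fin n => μ := by
    rw [hXindep.map_fun_eq_pi_map fun i => (hXmeas i).aemeasurable]
    simp only [hXlaw]
  have tail : ∀ t : ℝ, 0 < t →
      P.real {ω | UStat.completeU n K (fun i => X i ω) - UStat.theta μ K > t} ≤
        Real.exp (-((n : ℝ) * t ^ 2) /
          (2 * (m : ℝ) ^ 2 * UStat.sigmaSq μ K 1 + (m : ℝ) ^ 4 * UStat.beta μ K / (2 * (n : ℝ)) +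
            ((m : ℝ) ^ 2 * √(UStat.gamma μ K) + 4 / 3 * (m : ℝ)) * t)) := by
    intro t ht
    have h := UStat.completeU_tail_le (μ := μ) hKmeas hK hKsymm hm hmn ht
    rw [← hlaw, map_measureReal_apply hXm
      (measurableSet_lt measurable_const (hf.meas.sub_const _))] at h
    exact h
  refine ⟨tail, fun δ hδ hδe => ?_⟩
  have hm0 : (0 : ℝ) < m := by exact_mod_cast hm
  have hn0 : (0 : ℝ) < n := hm0.trans (by exact_mod_cast hmn)
  set L := Real.log (1 / δ) with hL
  have hL1 : 1 ≤ L := by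
    rw [hL, Real.le_log_iff_exp_le (by positivity), le_one_div (Real.exp_pos 1) hδ]
    exact hδe
  have hβ : 0 ≤ UStat.beta μ K := UStat.beta_nonneg
  have hσ := UStat.sigmaSq_nonneg (μ := μ) (K := K) 1
  set A := 2 * (m : ℝ) ^ 2 * UStat.sigmaSq μ K 1 +
    (m : ℝ) ^ 4 * UStat.beta μ K / (2 * (n : ℝ)) with hA
  set B := (m : ℝ) ^ 2 * √(UStat.gamma μ K) + 4 / 3 * (m : ℝ) with hB
  set t := √(2 * (m : ℝ) ^ 2 * UStat.sigmaSq μ K 1 * L / (n : ℝ)) +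
    (UStat.alpha μ K * (m : ℝ) ^ 2 + 4 * (m : ℝ) / 3) * L / (n : ℝ) with ht
  have hB0 : 0 < B := by positivity
  have hA0 : 0 ≤ A := by positivity
  -- The condition `δ ≤ 1 / e` means `1 ≤ L`, hence `√L ≤ L`: the `β` part of the square root moves
  -- into the term of order `L / n`, where it becomes the `√(β / 2)` of `alpha`.
  have hβs : √((m : ℝ) ^ 4 * UStat.beta μ K / (2 * (n : ℝ)) * L / n) ≤
      √(UStat.beta μ K / 2) * (m : ℝ) ^ 2 * L / n := by
    refine Real.sqrt_le_iff.2 ⟨by positivity, ?_⟩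
    rw [div_pow, mul_pow, mul_pow, Real.sq_sqrt (by positivity)]
    have : (m : ℝ) ^ 4 * UStat.beta μ K / (2 * (n : ℝ)) * L / n =
        UStat.beta μ K / 2 * ((m : ℝ) ^ 2) ^ 2 * L / (n : ℝ) ^ 2 := by
      field_simp
    rw [this]
    have : L ≤ L ^ 2 := by nlinarith
    gcongr
  have hle : √(A * L / n) + B * L / n ≤ t := by
    have h1 : A * L / n = 2 * (m : ℝ) ^ 2 * UStat.sigmaSq μ K 1 * L / n +
        (m : ℝ) ^ 4 * UStat.beta μ K / (2 * (n : ℝ)) * L / n := by rw [hA]; ring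
    have h2 := UStat.sqrt_add_le_sqrt_add_sqrt (x := 2 * (m : ℝ) ^ 2 * UStat.sigmaSq μ K 1 * L / n)
      (y := (m : ℝ) ^ 4 * UStat.beta μ K / (2 * (n : ℝ)) * L / n) (by positivity) (by positivity)
    rw [← h1] at h2
    have h3 : t = √(2 * (m : ℝ) ^ 2 * UStat.sigmaSq μ K 1 * L / (n : ℝ)) +
        √(UStat.beta μ K / 2) * (m : ℝ) ^ 2 * L / n + B * L / n := by
      rw [ht, hB, UStat.alpha]; ring
    linarith
  have ht0 : 0 < t := lt_of_lt_of_le (by positivity) hle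
  have hlt := (tail t ht0).trans
    (Real.exp_le_exp.2 (UStat.bernstein_inversion hA0 hB0 (by linarith) hn0 hle))
  rw [hL, Real.log_div one_ne_zero hδ.ne', Real.log_one, zero_sub, neg_neg, Real.exp_log hδ] at hlt
  have hmeas : MeasurableSet
      {ω | UStat.completeU n K (fun i => X i ω) - UStat.theta μ K > t} :=
    measurableSet_lt measurable_const ((hf.meas.comp hXm).sub_const _)
  have hc := probReal_compl_eq_one_sub (μ := P) hmeas
  have hs : {ω | UStat.completeU n K (fun i => X i ω) - UStat.theta μ K > t}ᶜ =
      {ω | UStat.completeU n K (fun i => X i ω) - UStat.theta μ K ≤ t} := by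
    ext ω; simp
  rw [hs] at hc
  linarith
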